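/- **Setting.** A Dyck bridge of size $N$ is a lattice path with $N$ up-steps $(+1,+1)$ and $N$ down-steps $(+1,-1)$ starting at $(0,0)$; it is a Dyck excursion if it never goes below height $0$. Let $\mathcal B_N$, $\mathcal C_N$ be the sets of bridges and excursions of size $N$, with $|\mathcal B_N|=\binom{2N}{N}$ and $|\mathcal C_N|=C_N=\frac1{N+1}\binom{2N}{N}$. The region between a path $w$ and the horizontal axis is cut by the lines of integer height into $N$ connected horizontal slices $e\in w$; the slice $e$ has odd length $\ell_w(e)$, measured at mid-height. For $\omega:\mathbb N\to\mathbb R$ and $\epsilon\in\mathbb R$ put $$A_{(\omega,\epsilon)}(w)=\sum_{e\in w}\Big[\omega\Big(\tfrac{\ell_w(e)-1}{2}\Big)-\epsilon\Big],$$ $$E_s(z)=\frac12\sum_{N\ge0}\sum_{w\in\mathcal C_N}\frac{A_{(\omega,\epsilon)}(w)^s}{s!}\Big(\frac z4\Big)^N,\qquad B_s(z)=\sum_{N\ge0}\sum_{w\in\mathcal B_N}\frac{A_{(\omega,\epsilon)}(w)^s}{s!}\Big(\frac z4\Big)^N,$$ $$M^{(E)}_s(N)=\frac1{C_N}\sum_{w\in\mathcal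 C_N}A_{(\omega,\epsilon)}(w)^s,\qquad M^{(B)}_s(N)=\binom{2N}{N}^{-1}\sum_{w\in\mathcal B_N}A_{(\omega,\epsilon)}(w)^s .$$ Write $f(z)=\tilde{\mathcal O}((1-z)^b)$ if, for some finite $c$, $f(z)=\mathcal O(|1-z|^b\,|\log|1-z||^c)$ as $z\to1$ inside every Stolz angle $\{|z|<1,\ |1-z|<M(1-|z|)\}$ of the unit disc, and $f(N)=\tilde{\mathcal O}(N^b)$ if $f(N)=\mathcal O(N^b(\log N)^c)$ as $N\to\infty$ for some finite $c$. Powers of $1-z$ are principal. Let $p>0$, $p\ne\frac12$, $\eta>0$, and suppose that $\omega(N)=N^p(1+\mathcal O(N^{-\eta}))$ as $N\to\infty$. A number $\alpha=\alpha(\omega)$ is a *regular constant* of $\omega$ if $$\sum_{N\ge0}2^{-2N-1}C_N\,\omega(N)z^N=\alpha+\frac{\Gamma(p-\frac12)}{2\sqrt\pi}(1-z)^{\frac12-p}+\tilde{\mathcal O}\big((1-z)^{\frac12-p+\min(\eta,\frac12)}\big).$$ Define $\mu^{(E)}_s=\mu^{(E)}_s(p)$ and $\mu^{(B)}_s=\mu^{(B)}_s(p)$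 by $$\mu^{(E)}_0=-\tfrac12,\qquad \mu^{(E)}_1=\frac{\Gamma(p-\frac12)}{8\sqrt\pi},\qquad \mu^{(E)}_s=\mu^{(E)}_{s-1}\frac{\Gamma(s(p+\frac12)-1)}{2\,\Gamma(s(p+\frac12)-p-1)}+\sum_{k=1}^{s-1}\mu^{(E)}_k\mu^{(E)}_{s-k}\quad(s\ge2),$$ $$\mu^{(B)}_0=1,\qquad \mu^{(B)}_s=2\sum_{k=0}^{s-1}\mu^{(B)}_k\mu^{(E)}_{s-k}\quad(s\ge1).$$ Put $\hat\eta=\min(\eta,p,\frac12)$, and $\eta_1=\min(\eta,\frac12)$, $\eta_s=\hat\eta$ for $s\ge2$. **Proposition.** A regular constant exists, and for every regular constant $\alpha$ the following hold with $\epsilon=\alpha$. All the series $E_s$, $B_s$ converge in the open unit disc. 1. For every $s\ge1$, as $z\to1$, $$E_s(z)=2\mu^{(E)}_s(1-z)^{-(p+\frac12)s+\frac12}+\tilde{\mathcal O}\big((1-z)^{-(p+\frac12)s+\frac12+\hat\eta}\big),$$ $$B_s(z)=\mu^{(B)}_s(1-z)^{-(p+\frac12)s-\frac12}+\tilde{\mathcal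 O}\big((1-z)^{-(p+\frac12)s-\frac12+\hat\eta}\big).$$ Moreover, for every $s\ge1$ there is a constant $c$ such that the expansion of $E_s(z)-c$ holds with $\hat\eta$ replaced by $\eta_s$. 2. For every $s\ge0$, $$\lim_{N\to\infty}\frac{M^{(E)}_s(N)}{N^{s(p+\frac12)}}=\frac{4\sqrt\pi\,s!}{\Gamma((p+\frac12)s-\frac12)}\mu^{(E)}_s,\qquad \lim_{N\to\infty}\frac{M^{(B)}_s(N)}{N^{s(p+\frac12)}}=\frac{\sqrt\pi\,s!}{\Gamma((p+\frac12)s+\frac12)}\mu^{(B)}_s .$$ For $s\ge1$, the difference between $M^{(E)}_s(N)$ and its limit times $N^{s(p+\frac12)}$ is $\tilde{\mathcal O}(N^{s(p+\frac12)-\eta_s})$, and the corresponding difference for $M^{(B)}_s(N)$ is $\tilde{\mathcal O}(N^{s(p+\frac12)-\hat\eta})$. -/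

import Mathlib

open Filter Topology Asymptotics

namespace PAiry

noncomputable section

/-! ### Lattice paths and their horizontal slices -/

/-- Height of the lattice path with step list `l` (`U` is `+1`, `D` is `-1`) after `k` steps. -/
def height (l : List DyckStep) (k : ℕ) : ℤ :=
  ((l.take k).count DyckStep.U : ℤ) - ((l.take k).count DyckStep.D : ℤ)

/-- The pair of positions `(i, j)` bounds a connected horizontal slice of the region between the
path `l` and the horizontal axis: the path leaves the height `height l i` with step number `i`,
moving away from the axis, stays strictly beyond that height, and returns to it for the first time
with step number `j` (steps are numbered from `0`). The slice goes from the middle of step `i` to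
the middle of step `j`, so its length is `j - i`. The first alternative is a slice above the axis,
the second one a slice below the axis. -/
def IsSlice (l : List DyckStep) (i j : ℕ) : Prop :=
  i < j ∧ j < l.length ∧ height l (j + 1) = height l i ∧
    ((0 ≤ height l i ∧ ∀ k, i < k → k ≤ j → height l i < height l k) ∨
      (height l i ≤ 0 ∧ ∀ k, i < k → k ≤ j → height l k < height l i))

open Classical in
/-- The finite set of connected horizontal slices of the path `l`. -/
def slices (l : List DyckStep) : Finset (ℕ × ℕ) :=
  (Finset.range l.length ×ˢ Finset.range l.length).filter fun e => IsSlice l e.1 e.2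

/-- The shifted deformed area: the sum of `ω ((ℓ - 1) / 2) - ε` over the horizontal slices, where
`ℓ = j - i` is the length of the slice `(i, j)` (an odd number, so that the division is exact). -/
def area (ω : ℕ → ℝ) (ε : ℝ) (l : List DyckStep) : ℝ :=
  ∑ e ∈ slices l, (ω ((e.2 - e.1 - 1) / 2) - ε)

/-- The Dyck bridges of size `N`: the step lists with `N` up-steps and `N` down-steps. -/
def bridges (N : ℕ) : Finset (List DyckStep) :=
  (List.replicate N DyckStep.U ++ List.replicate N DyckStep.D).permutations.toFinset

theorem mem_bridges (N : ℕ) (l : List DyckStep) :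
    l ∈ bridges N ↔ l.count DyckStep.U = N ∧ l.count DyckStep.D = N := by
  simp only [bridges, List.mem_toFinset, List.mem_permutations, List.perm_iff_count]
  constructor
  · intro h
    constructor
    · simpa [List.count_replicate] using h DyckStep.U
    · simpa [List.count_replicate] using h DyckStep.D
  · rintro ⟨h1, h2⟩ a
    cases a
    · simpa [List.count_replicate] using h1
    · simpa [List.count_replicate] using h2

/-! ### Moments and generating functions

Excursions (Dyck paths) of size `N` are Mathlib's Dyck words of semilength `N`. -/

/-- Sum of the `s`-th powers of the shifted area over all excursions of size `N`. -/
def excursionSum (ω : ℕ → ℝ) (ε : ℝ) (s N : ℕ) : ℝ :=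
  ∑ w : {w : DyckWord // w.semilength = N}, area ω ε w.1.toList ^ s

/-- Sum of the `s`-th powers of the shifted area over all bridges of size `N`. -/
def bridgeSum (ω : ℕ → ℝ) (ε : ℝ) (s N : ℕ) : ℝ :=
  ∑ l ∈ bridges N, area ω ε l ^ s

/-- The `s`-th moment of the shifted area of a uniform excursion of size `N`. -/
def momentE (ω : ℕ → ℝ) (ε : ℝ) (s N : ℕ) : ℝ :=
  excursionSum ω ε s N / (catalan N : ℝ)

/-- The `s`-th moment of the shifted area of a uniform bridge of size `N`. -/
def momentB (ω : ℕ → ℝ) (ε : ℝ) (s N : ℕ) : ℝ :=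
  bridgeSum ω ε s N / (Nat.centralBinom N : ℝ)

/-- The coefficient of `z ^ N` in `E_s(z)`. -/
def coeffE (ω : ℕ → ℝ) (ε : ℝ) (s N : ℕ) : ℝ :=
  1 / 2 * (excursionSum ω ε s N / (s.factorial : ℝ)) * (1 / 4) ^ N

/-- The coefficient of `z ^ N` in `B_s(z)`. -/
def coeffB (ω : ℕ → ℝ) (ε : ℝ) (s N : ℕ) : ℝ :=
  bridgeSum ω ε s N / (s.factorial : ℝ) * (1 / 4) ^ N

/-- The generating function `E_s(z)` of excursions, on the open unit disc. -/
def genE (ω : ℕ → ℝ) (ε : ℝ) (s : ℕ) (z : ℂ) : ℂ :=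
  ∑' N : ℕ, (coeffE ω ε s N : ℂ) * z ^ N

/-- The generating function `B_s(z)` of bridges, on the open unit disc. -/
def genB (ω : ℕ → ℝ) (ε : ℝ) (s : ℕ) (z : ℂ) : ℂ :=
  ∑' N : ℕ, (coeffB ω ε s N : ℂ) * z ^ N

/-! ### Asymptotic notation -/

/-- `f(z) = Õ((1-z)^b)` as `z → 1`, that is, `O(|1-z|^b |log |1-z||^c)` for some finite `c`; here
`z` tends to `1` in every Stolz angle `{z : |z| < 1, |1 - z| < M (1 - |z|)}` of the unit disc. -/
def TildeO (f : ℂ → ℂ) (b : ℝ) : Prop :=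
  ∃ c : ℕ, ∀ M : ℝ,
    f =O[𝓝[Complex.stolzSet M] 1] fun z => ‖1 - z‖ ^ b * |Real.log ‖1 - z‖| ^ c

/-- `f(N) = Õ(N^b)` as `N → ∞`, that is, `O(N^b (log N)^c)` for some finite `c`. -/
def TildeONat (f : ℕ → ℝ) (b : ℝ) : Prop :=
  ∃ c : ℕ, f =O[atTop] fun N : ℕ => (N : ℝ) ^ b * Real.log (N : ℝ) ^ c

/-! ### The constant `α(ω)` -/

/-- The function `∑_N c_N ω(N) z^N`, where `c_N = 2^{-2N-1} C_N` are the normalized Catalan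
numbers, the coefficients of `E_0(z)`. -/
def hadamardE0 (ω : ℕ → ℝ) (z : ℂ) : ℂ :=
  ∑' N : ℕ, (((catalan N : ℝ) / 2 ^ (2 * N + 1) * ω N : ℝ) : ℂ) * z ^ N

/-- `α` is the constant term `α(ω)` in the singular expansion at `z = 1`
`∑_N c_N ω(N) z^N = α + Γ(p-1/2)/(2√π) (1-z)^{1/2-p} (1 + Õ((1-z)^{min(η,1/2)}))`. -/
def IsRegularConstant (ω : ℕ → ℝ) (p η α : ℝ) : Prop :=
  TildeO
    (fun z => hadamardE0 ω z -
      ((α : ℂ) + ((Real.Gamma (p - 1 / 2) / (2 * √Real.pi) : ℝ) : ℂ) *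
        (1 - z) ^ ((1 / 2 - p : ℝ) : ℂ)))
    (1 / 2 - p + min η (1 / 2))

/-! ### The universal coefficients -/

/-- The coefficients `μ^{(E)}_s(p)`. -/
def muE (p : ℝ) : ℕ → ℝ
  | 0 => -1 / 2
  | 1 => Real.Gamma (p - 1 / 2) / (8 * √Real.pi)
  | s + 2 =>
      muE p (s + 1) * (Real.Gamma (((s + 2 : ℕ) : ℝ) * (p + 1 / 2) - 1) /
          (2 * Real.Gamma (((s + 2 : ℕ) : ℝ) * (p + 1 / 2) - p - 1))) +
        ∑ k : Fin (s + 1), muE p (k.1 + 1) * muE p (s + 1 - k.1)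
  termination_by s => s

/-- The coefficients `μ^{(B)}_s(p)`. -/
def muB (p : ℝ) : ℕ → ℝ
  | 0 => 1
  | s + 1 => 2 * ∑ k : Fin (s + 1), muB p k.1 * muE p (s + 1 - k.1)
  termination_by s => s

theorem muE_zero (p : ℝ) : muE p 0 = -1 / 2 := by
  rw [muE]

theorem muE_one (p : ℝ) : muE p 1 = Real.Gamma (p - 1 / 2) / (8 * √Real.pi) := by
  rw [muE]

theorem muE_rec (p : ℝ) (s : ℕ) (hs : 2 ≤ s) :
    muE p s = muE p (s - 1) * (Real.Gamma ((s : ℝ) * (p + 1 / 2) - 1) /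
        (2 * Real.Gamma ((s : ℝ) * (p + 1 / 2) - p - 1))) +
      ∑ k ∈ Finset.Icc 1 (s - 1), muE p k * muE p (s - k) := by
  obtain ⟨s, rfl⟩ := Nat.exists_eq_add_of_le' hs
  rw [muE, Fin.sum_univ_eq_sum_range (fun k => muE p (k + 1) * muE p (s + 1 - k)) (s + 1)]
  congr 1
  rw [← Finset.Ico_add_one_right_eq_Icc, Finset.sum_Ico_eq_sum_range]
  refine Finset.sum_congr rfl fun k hk => ?_
  rw [add_comm 1 k]
  congr 2
  omega

theorem muB_zero (p : ℝ) : muB p 0 = 1 := by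
  rw [muB]

theorem muB_rec (p : ℝ) (s : ℕ) (hs : 1 ≤ s) :
    muB p s = 2 * ∑ k ∈ Finset.range s, muB p k * muE p (s - k) := by
  obtain ⟨s, rfl⟩ := Nat.exists_eq_add_of_le' hs
  rw [muB, Fin.sum_univ_eq_sum_range (fun k => muB p k * muE p (s + 1 - k)) (s + 1)]

/-! ### Exponents -/

/-- The exponent `(p + 1/2) s - 1/2` of `E_s`. -/
def expE (p : ℝ) (s : ℕ) : ℝ := (p + 1 / 2) * s - 1 / 2

/-- The exponent `(p + 1/2) s + 1/2` of `B_s`. -/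
def expB (p : ℝ) (s : ℕ) : ℝ := (p + 1 / 2) * s + 1 / 2

/-- The error exponent `η_s`, for `s ≥ 1`. -/
def errExp (p η : ℝ) (s : ℕ) : ℝ :=
  if s = 1 then min η (1 / 2) else min η (min p (1 / 2))

end

end PAiry

/-!
The proof works with coefficients of power series, not with analytic continuation: an error term
`O(N ^ (p-η))` in `ω N` says nothing about singularities outside the unit disc, but it survives
convolution, and it passes to Stolz angles at `z = 1` by Abelian estimates.

*Combinatorics.* Cutting a path at its first return to the axis splits the area into that of a
lifted excursion and that of the rest (`area_append`), and lifting an excursion of size `N` adds the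
single slice `ω N - ε` (`area_nest`). Summing over all paths gives
`2 E_s = [s = 0] + X ∑ L_j E_k` and `B_s = [s = 0] + X ∑ L_j B_k` over `j + k = s`
(`two_mul_seriesE`, `seriesB_eq`), where `L_j = ∑ (ω - ε) ^ i / i! ⊙ E_{j-i}` is `seriesLift` and
`⊙` is the coefficientwise product. For `s = 0` this gives `1 - X E_0 = (1 - X) ^ (1/2)`, so that
for `s ≥ 1` the equations are linear in `E_s` and `B_s`, and are solved by a factor
`(1 - X) ^ (-1/2)` (`two_mul_seriesE_succ`, `seriesB_succ`).

*Singular terms.* `HasSingularTerm f β δ c` says that the coefficients of `f` are those of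
`c (1 - X) ^ (-β)` up to `Õ(N ^ (β-1-δ))`. For `0 ≤ δ ≤ β` and `δ ≤ γ` this is stable under
products, where exponents add and constants multiply (`HasSingularTerm.mul`), because convolving
`Õ(N ^ (β-1))` with `Õ(N ^ (γ-1))` gives `Õ(N ^ (β+γ-1))` when `β, γ ≥ 0` (`TildeONat.conv`).
Multiplying the coefficients by `ω` multiplies the constant by a quotient of Gamma values and raises
the exponent by `p` (`HasSingularTerm.hadamard`). All `E_s` with `s ≥ 1` have exponent at least `p`,
so with `δ = min η (min p (1/2))` an induction on `s` yields the recursions for `muE` and `muB`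
(`hasSingularTerm_seriesE`, `hasSingularTerm_seriesB`); of the terms of `L_s - E_s` only the one
linear in `ω - ε` matters.

*The first step.* For `s = 1` the series `(ω - α) ⊙ E_0` may have summable coefficients, and the
error must be controlled through a cancellation. Write `∑ c_N ω(N) X^N` as its singular term plus
`regularPart`. A regular constant is what has to be subtracted from `regularPart` to make it
`Õ((1-z) ^ κ)` at `1`, where `κ = 1/2 - p + min η (1/2)`. If `κ > 0`, this forces `α` to be the
sum of the coefficients of `regularPart` (`IsRegularConstant.eq_tsum`). In either case the
coefficients `Õ(N ^ (-κ-1))` of `regularPart - α` turn into `Õ(N ^ (-κ-1/2))` under multiplication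
by `(1 - X) ^ (-1/2)` (`TildeONat.invPow_half_mul`). The rest is
`α (1 - X) ^ (-1/2) (1 - E_0) = α E_0`, which is where the additive constant in the sharper
expansion of `E_1` comes from.

*Conclusion.* Sequences of size `Õ(N ^ (-κ-1))` with `κ < 1` have power series `a + Õ((1-z) ^ κ)` in
Stolz angles, with `a = 0` when `κ ≤ 0` (`TildeONat.exists_tildeO_tsum_sub`). The moments are `s!`
times the quotients of the coefficients of `E_s` by those of `E_0`, and of `B_s` by those of `B_0`.
-/

open Finset.HasAntidiagonal (antidiagonal mem_antidiagonal)

namespace PAiry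

noncomputable section

/-! ### Sequences of size `Õ(N ^ b)` -/

/-- Powers of two positive reals that agree up to a factor `K` agree up to a factor `K ^ |b|`. -/
theorem rpow_le_of_comparable {x y K : ℝ} (hx : 0 < x) (hy : 0 < y) (hK : 1 ≤ K)
    (hxy : x ≤ K * y) (hyx : y ≤ K * x) (b : ℝ) : x ^ b ≤ K ^ |b| * y ^ b := by
  have hK0 : 0 < K := by linarith
  rcases le_or_gt 0 b with hb | hb
  · rw [abs_of_nonneg hb, ← Real.mul_rpow hK0.le hy.le]
    exact Real.rpow_le_rpow hx.le hxy hb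
  · have h1 : x ^ b ≤ (y / K) ^ b :=
      Real.rpow_le_rpow_of_nonpos (by positivity) (by rw [div_le_iff₀ hK0]; linarith) hb.le
    rw [Real.div_rpow hy.le hK0.le] at h1
    rw [abs_of_neg hb, Real.rpow_neg hK0.le]
    rw [div_eq_inv_mul] at h1
    exact h1

/-- The weight `1 + log (N + 1)`, a version of `log N` that is never smaller than `1`. -/
def logWeight (N : ℕ) : ℝ := 1 + Real.log ((N : ℝ) + 1)

theorem one_le_logWeight (N : ℕ) : 1 ≤ logWeight N := by
  have : 0 ≤ Real.log ((N : ℝ) + 1) := Real.log_nonneg (by linarith [N.cast_nonneg (α := ℝ)])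
  unfold logWeight
  linarith

theorem logWeight_pos (N : ℕ) : 0 < logWeight N := by linarith [one_le_logWeight N]

theorem logWeight_mono {m n : ℕ} (h : m ≤ n) : logWeight m ≤ logWeight n := by
  unfold logWeight
  have : (m : ℝ) ≤ n := by exact_mod_cast h
  gcongr

/-- A bound that holds for all `N`, without the degenerate values of `N ^ b * log N ^ c` at small
`N`. -/
theorem tildeONat_iff {f : ℕ → ℝ} {b : ℝ} :
    TildeONat f b ↔ ∃ C : ℝ, ∃ c : ℕ, 0 < C ∧
      ∀ N : ℕ, |f N| ≤ C * (((N : ℝ) + 1) ^ b * logWeight N ^ c) := by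
  constructor
  · rintro ⟨c, hc⟩
    have h : f =O[atTop] fun N : ℕ => ((N : ℝ) + 1) ^ b * logWeight N ^ c := by
      refine hc.trans (IsBigO.of_bound (2 ^ |b|) ?_)
      filter_upwards [eventually_ge_atTop 1] with N hN
      have hN' : (1 : ℝ) ≤ N := by exact_mod_cast hN
      have h0 : 0 ≤ Real.log (N : ℝ) := Real.log_nonneg hN'
      have h1 : (N : ℝ) ^ b ≤ 2 ^ |b| * ((N : ℝ) + 1) ^ b :=
        rpow_le_of_comparable (by linarith) (by linarith) (by norm_num) (by linarith)
          (by linarith) b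
      have h2 : Real.log (N : ℝ) ≤ logWeight N := by
        have : Real.log (N : ℝ) ≤ Real.log ((N : ℝ) + 1) :=
          Real.log_le_log (by linarith) (by linarith)
        unfold logWeight
        linarith
      have h3 := logWeight_pos N
      rw [Real.norm_of_nonneg (by positivity), Real.norm_of_nonneg (by positivity), ← mul_assoc]
      gcongr
    obtain ⟨C, hC, hb⟩ := bound_of_isBigO_nat_atTop h
    refine ⟨C, c, hC, fun N => ?_⟩
    have h3 := logWeight_pos N
    have := hb (x := N) (by positivity)
    rwa [Real.norm_eq_abs, Real.norm_of_nonneg (by positivity)] at this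
  · rintro ⟨C, c, hC, h⟩
    refine ⟨c, IsBigO.of_bound (C * (2 ^ |b| * 3 ^ c)) ?_⟩
    filter_upwards [eventually_ge_atTop 3] with N hN
    have hN' : (3 : ℝ) ≤ N := by exact_mod_cast hN
    have hl : 1 ≤ Real.log (N : ℝ) := by
      rw [Real.le_log_iff_exp_le (by linarith)]
      linarith [Real.exp_one_lt_d9]
    have h1 : ((N : ℝ) + 1) ^ b ≤ 2 ^ |b| * (N : ℝ) ^ b :=
      rpow_le_of_comparable (by linarith) (by linarith) (by norm_num) (by linarith)
        (by linarith) b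
    have h2 : logWeight N ≤ 3 * Real.log (N : ℝ) := by
      have : Real.log ((N : ℝ) + 1) ≤ Real.log ((N : ℝ) * N) :=
        Real.log_le_log (by linarith) (by nlinarith)
      rw [Real.log_mul (by linarith) (by linarith)] at this
      unfold logWeight
      linarith
    have h3 := logWeight_pos N
    rw [Real.norm_eq_abs, Real.norm_of_nonneg (by positivity)]
    calc |f N| ≤ C * (((N : ℝ) + 1) ^ b * logWeight N ^ c) := h N
      _ ≤ C * ((2 ^ |b| * (N : ℝ) ^ b) * (3 * Real.log (N : ℝ)) ^ c) := by gcongr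
      _ = _ := by rw [mul_pow]; ring

theorem TildeONat.of_isBigO {f : ℕ → ℝ} {b : ℝ}
    (h : f =O[atTop] fun N : ℕ => (N : ℝ) ^ b) : TildeONat f b :=
  ⟨0, by simpa using h⟩

theorem tildeONat_rpow (b : ℝ) : TildeONat (fun N : ℕ => (N : ℝ) ^ b) b :=
  .of_isBigO (isBigO_refl _ _)

theorem TildeONat.mono {f : ℕ → ℝ} {b b' : ℝ} (h : TildeONat f b) (hb : b ≤ b') :
    TildeONat f b' := by
  obtain ⟨C, c, hC, h⟩ := tildeONat_iff.1 h
  refine tildeONat_iff.2 ⟨C, c, hC, fun N => (h N).trans ?_⟩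
  have h3 := logWeight_pos N
  have h4 : (1 : ℝ) ≤ (N : ℝ) + 1 := by linarith [N.cast_nonneg (α := ℝ)]
  gcongr

theorem TildeONat.congr' {f g : ℕ → ℝ} {b : ℝ} (h : TildeONat f b) (hfg : f =ᶠ[atTop] g) :
    TildeONat g b := by
  obtain ⟨c, h⟩ := h
  exact ⟨c, h.congr' hfg EventuallyEq.rfl⟩

theorem TildeONat.const_mul {f : ℕ → ℝ} {b : ℝ} (h : TildeONat f b) (a : ℝ) :
    TildeONat (fun N => a * f N) b := by
  obtain ⟨c, h⟩ := h
  exact ⟨c, h.const_mul_left a⟩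

theorem TildeONat.neg {f : ℕ → ℝ} {b : ℝ} (h : TildeONat f b) : TildeONat (fun N => -f N) b := by
  obtain ⟨c, h⟩ := h
  exact ⟨c, h.neg_left⟩

theorem TildeONat.mul {f g : ℕ → ℝ} {a b : ℝ} (hf : TildeONat f a) (hg : TildeONat g b) :
    TildeONat (fun N => f N * g N) (a + b) := by
  obtain ⟨C, c, hC, hf⟩ := tildeONat_iff.1 hf
  obtain ⟨D, d, hD, hg⟩ := tildeONat_iff.1 hg
  refine tildeONat_iff.2 ⟨C * D, c + d, by positivity, fun N => ?_⟩
  have h3 := logWeight_pos N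
  have h4 : (0 : ℝ) < (N : ℝ) + 1 := by positivity
  rw [abs_mul, Real.rpow_add h4, pow_add]
  calc |f N| * |g N| ≤ _ := mul_le_mul (hf N) (hg N) (abs_nonneg _) (by positivity)
    _ = _ := by ring

theorem TildeONat.add {f g : ℕ → ℝ} {b : ℝ} (hf : TildeONat f b) (hg : TildeONat g b) :
    TildeONat (fun N => f N + g N) b := by
  obtain ⟨C, c, hC, hf⟩ := tildeONat_iff.1 hf
  obtain ⟨D, d, hD, hg⟩ := tildeONat_iff.1 hg
  refine tildeONat_iff.2 ⟨C + D, c + d, by positivity, fun N => ?_⟩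
  have h3 := one_le_logWeight N
  calc |f N + g N| ≤ |f N| + |g N| := abs_add_le _ _
    _ ≤ C * (((N : ℝ) + 1) ^ b * logWeight N ^ c) + D * (((N : ℝ) + 1) ^ b * logWeight N ^ d) :=
      add_le_add (hf N) (hg N)
    _ ≤ C * (((N : ℝ) + 1) ^ b * logWeight N ^ (c + d)) +
        D * (((N : ℝ) + 1) ^ b * logWeight N ^ (c + d)) := by
      gcongr <;> first | exact h3 | omega
    _ = _ := by ring

theorem TildeONat.sub {f g : ℕ → ℝ} {b : ℝ} (hf : TildeONat f b) (hg : TildeONat g b) :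
    TildeONat (fun N => f N - g N) b := by
  simpa [sub_eq_add_neg] using hf.add hg.neg

theorem tildeONat_zero (b : ℝ) : TildeONat (fun _ => 0) b := ⟨0, isBigO_zero _ _⟩

theorem TildeONat.sum {ι : Type*} {s : Finset ι} {f : ι → ℕ → ℝ} {b : ℝ}
    (h : ∀ i ∈ s, TildeONat (f i) b) : TildeONat (fun N => ∑ i ∈ s, f i N) b := by
  classical
  induction s using Finset.induction_on with
  | empty => simpa using tildeONat_zero b
  | insert a s ha ih =>
    simp only [Finset.sum_insert ha]
    exact (h a (Finset.mem_insert_self _ _)).add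
      (ih fun i hi => h i (Finset.mem_insert_of_mem hi))

/-- Delaying a sequence by one step does not change its order of growth. -/
theorem TildeONat.of_succ {f : ℕ → ℝ} {b : ℝ} (h : TildeONat (fun N => f (N + 1)) b) :
    TildeONat f b := by
  obtain ⟨C, c, hC, h⟩ := tildeONat_iff.1 h
  refine tildeONat_iff.2 ⟨|f 0| + C * 2 ^ |b|, c, by positivity, fun N => ?_⟩
  have h3 := logWeight_pos N
  rcases N with _ | N
  · have : (0 : ℝ) ≤ C * 2 ^ |b| := by positivity
    simpa [logWeight] using this
  · have h4 : ((N : ℝ) + 1) ^ b ≤ 2 ^ |b| * (((N + 1 : ℕ) : ℝ) + 1) ^ b := by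
      push_cast
      exact rpow_le_of_comparable (by positivity) (by positivity) (by norm_num)
        (by linarith [N.cast_nonneg (α := ℝ)]) (by linarith [N.cast_nonneg (α := ℝ)]) b
    have h5 := logWeight_mono (Nat.le_succ N)
    have h6 := logWeight_pos N
    calc |f (N + 1)| ≤ C * (((N : ℝ) + 1) ^ b * logWeight N ^ c) := h N
      _ ≤ C * ((2 ^ |b| * (((N + 1 : ℕ) : ℝ) + 1) ^ b) * logWeight (N + 1) ^ c) := by gcongr
      _ = (C * 2 ^ |b|) * ((((N + 1 : ℕ) : ℝ) + 1) ^ b * logWeight (N + 1) ^ c) := by ring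
      _ ≤ _ := by
        gcongr
        linarith [abs_nonneg (f 0)]

theorem TildeONat.succ {f : ℕ → ℝ} {b : ℝ} (h : TildeONat f b) :
    TildeONat (fun N => f (N + 1)) b := by
  obtain ⟨C, c, hC, h⟩ := tildeONat_iff.1 h
  refine tildeONat_iff.2 ⟨C * (2 ^ |b| * 2 ^ c), c, by positivity, fun N => ?_⟩
  have h4 : (((N + 1 : ℕ) : ℝ) + 1) ^ b ≤ 2 ^ |b| * ((N : ℝ) + 1) ^ b := by
    push_cast
    exact rpow_le_of_comparable (by positivity) (by positivity) (by norm_num)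
      (by linarith [N.cast_nonneg (α := ℝ)]) (by linarith [N.cast_nonneg (α := ℝ)]) b
  have h5 : logWeight (N + 1) ≤ 2 * logWeight N := by
    have h0 : (0 : ℝ) ≤ N := N.cast_nonneg
    have h7 : Real.log (((N + 1 : ℕ) : ℝ) + 1) ≤ Real.log (2 * ((N : ℝ) + 1)) := by
      push_cast
      exact Real.log_le_log (by positivity) (by linarith)
    rw [Real.log_mul (by norm_num) (by positivity)] at h7
    have h8 : 0 ≤ Real.log ((N : ℝ) + 1) := Real.log_nonneg (by linarith)
    have := Real.log_two_lt_d9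
    unfold logWeight
    linarith
  have h6 := logWeight_pos N
  have h9 := logWeight_pos (N + 1)
  calc |f (N + 1)| ≤ _ := h (N + 1)
    _ ≤ C * ((2 ^ |b| * ((N : ℝ) + 1) ^ b) * (2 * logWeight N) ^ c) := by gcongr
    _ = _ := by rw [mul_pow]; ring

/-! ### Convolutions -/

theorem sum_inv_succ_le_logWeight (N : ℕ) :
    ∑ i ∈ Finset.range (N + 1), 1 / ((i : ℝ) + 1) ≤ logWeight N := by
  have h := harmonic_le_one_add_log (N + 1)
  rw [harmonic] at h
  push_cast at h
  simpa [logWeight] using h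

theorem sum_antidiagonal_rpow_mul_rpow_le {β γ : ℝ} (hβ : 0 ≤ β) (hγ : 0 ≤ γ) :
    ∃ K : ℝ, 0 < K ∧ ∀ N : ℕ, ∑ x ∈ antidiagonal N,
      ((x.1 : ℝ) + 1) ^ (β - 1) * ((x.2 : ℝ) + 1) ^ (γ - 1) ≤
        K * (((N : ℝ) + 1) ^ (β + γ - 1) * logWeight N) := by
  -- The larger of the two indices is comparable to `N`.
  have key : ∀ {β γ : ℝ}, 0 ≤ β → ∀ i j : ℕ, i ≤ j →
      ((i : ℝ) + 1) ^ (β - 1) * ((j : ℝ) + 1) ^ (γ - 1) ≤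
        2 ^ |γ - 1| * (((i + j : ℕ) : ℝ) + 1) ^ (β + γ - 1) * (1 / ((i : ℝ) + 1)) := by
    intro β γ hβ i j hij
    have hij' : (i : ℝ) ≤ j := by exact_mod_cast hij
    have hi : (0 : ℝ) ≤ i := i.cast_nonneg
    push_cast
    have h1 : ((j : ℝ) + 1) ^ (γ - 1) ≤ 2 ^ |γ - 1| * ((i : ℝ) + j + 1) ^ (γ - 1) :=
      rpow_le_of_comparable (by linarith) (by linarith) (by norm_num) (by linarith)
        (by linarith) _
    have h2 : ((i : ℝ) + 1) ^ (β - 1) ≤ ((i : ℝ) + j + 1) ^ β * (1 / ((i : ℝ) + 1)) := by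
      rw [Real.rpow_sub_one (by linarith), div_eq_mul_one_div]
      gcongr
      linarith
    calc _ ≤ (((i : ℝ) + j + 1) ^ β * (1 / ((i : ℝ) + 1))) *
          (2 ^ |γ - 1| * ((i : ℝ) + j + 1) ^ (γ - 1)) := by gcongr
      _ = _ := by
        rw [show β + γ - 1 = β + (γ - 1) by ring, Real.rpow_add (by linarith)]
        ring
  refine ⟨2 * (2 ^ |γ - 1| + 2 ^ |β - 1|), by positivity, fun N => ?_⟩
  have hterm : ∀ x ∈ antidiagonal N,
      ((x.1 : ℝ) + 1) ^ (β - 1) * ((x.2 : ℝ) + 1) ^ (γ - 1) ≤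
        (2 ^ |γ - 1| + 2 ^ |β - 1|) * ((N : ℝ) + 1) ^ (β + γ - 1) * (1 / ((x.1 : ℝ) + 1)) +
        (2 ^ |γ - 1| + 2 ^ |β - 1|) * ((N : ℝ) + 1) ^ (β + γ - 1) * (1 / ((x.2 : ℝ) + 1)) := by
    rintro ⟨i, j⟩ hx
    rw [mem_antidiagonal] at hx
    subst hx
    have p1 : (0 : ℝ) < 2 ^ |γ - 1| := by positivity
    have p2 : (0 : ℝ) < 2 ^ |β - 1| := by positivity
    dsimp only
    rcases le_total i j with hij | hij
    · refine ((key hβ i j hij).trans ?_).trans (le_add_of_nonneg_right (by positivity))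
      gcongr
      linarith
    · have := key (γ := β) hγ j i hij
      rw [mul_comm, add_comm j i, add_comm γ β] at this
      refine (this.trans ?_).trans (le_add_of_nonneg_left (by positivity))
      gcongr
      linarith
  refine (Finset.sum_le_sum hterm).trans ?_
  rw [Finset.sum_add_distrib, ← Finset.mul_sum, ← Finset.mul_sum]
  have e1 : ∑ x ∈ antidiagonal N, 1 / ((x.1 : ℝ) + 1) ≤ logWeight N := by
    rw [Finset.Nat.sum_antidiagonal_eq_sum_range_succ (fun i _ => 1 / ((i : ℝ) + 1))]
    exact sum_inv_succ_le_logWeight N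
  have e2 : ∑ x ∈ antidiagonal N, 1 / ((x.2 : ℝ) + 1) ≤ logWeight N := by
    rw [← Finset.Nat.sum_antidiagonal_swap]
    exact e1
  calc _ ≤ (2 ^ |γ - 1| + 2 ^ |β - 1|) * ((N : ℝ) + 1) ^ (β + γ - 1) * logWeight N +
        (2 ^ |γ - 1| + 2 ^ |β - 1|) * ((N : ℝ) + 1) ^ (β + γ - 1) * logWeight N := by gcongr
    _ = _ := by ring

/-- Convolution multiplies generating functions, so that the exponents `β`, `γ` of the
singularities add up. -/
theorem TildeONat.conv {f g : ℕ → ℝ} {β γ : ℝ} (hβ : 0 ≤ β) (hγ : 0 ≤ γ)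
    (hf : TildeONat f (β - 1)) (hg : TildeONat g (γ - 1)) :
    TildeONat (fun N => ∑ x ∈ antidiagonal N, f x.1 * g x.2) (β + γ - 1) := by
  obtain ⟨C, c, hC, hf⟩ := tildeONat_iff.1 hf
  obtain ⟨D, d, hD, hg⟩ := tildeONat_iff.1 hg
  obtain ⟨K, hK, hs⟩ := sum_antidiagonal_rpow_mul_rpow_le hβ hγ
  refine tildeONat_iff.2 ⟨C * D * K, c + d + 1, by positivity, fun N => ?_⟩
  have h3 := logWeight_pos N
  calc |∑ x ∈ antidiagonal N, f x.1 * g x.2|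
      ≤ ∑ x ∈ antidiagonal N, C * D * logWeight N ^ (c + d) *
          (((x.1 : ℝ) + 1) ^ (β - 1) * ((x.2 : ℝ) + 1) ^ (γ - 1)) := by
        refine (Finset.abs_sum_le_sum_abs _ _).trans (Finset.sum_le_sum fun x hx => ?_)
        have hx1 := logWeight_mono (show x.1 ≤ N by rw [mem_antidiagonal] at hx; omega)
        have hx2 := logWeight_mono (show x.2 ≤ N by rw [mem_antidiagonal] at hx; omega)
        have hp1 := logWeight_pos x.1
        have hp2 := logWeight_pos x.2
        rw [abs_mul]
        calc |f x.1| * |g x.2| ≤ (C * (((x.1 : ℝ) + 1) ^ (β - 1) * logWeight x.1 ^ c)) *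
              (D * (((x.2 : ℝ) + 1) ^ (γ - 1) * logWeight x.2 ^ d)) :=
              mul_le_mul (hf _) (hg _) (abs_nonneg _) (by positivity)
          _ ≤ (C * (((x.1 : ℝ) + 1) ^ (β - 1) * logWeight N ^ c)) *
              (D * (((x.2 : ℝ) + 1) ^ (γ - 1) * logWeight N ^ d)) := by gcongr
          _ = _ := by ring
    _ ≤ C * D * logWeight N ^ (c + d) * (K * (((N : ℝ) + 1) ^ (β + γ - 1) * logWeight N)) := by
        rw [← Finset.mul_sum]
        gcongr
        exact hs N
    _ = _ := by ring

theorem TildeONat.coeff_mul {f g : PowerSeries ℝ} {β γ : ℝ} (hβ : 0 ≤ β) (hγ : 0 ≤ γ)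
    (hf : TildeONat (fun N => PowerSeries.coeff N f) (β - 1))
    (hg : TildeONat (fun N => PowerSeries.coeff N g) (γ - 1)) :
    TildeONat (fun N => PowerSeries.coeff N (f * g)) (β + γ - 1) := by
  simpa only [PowerSeries.coeff_mul] using TildeONat.conv hβ hγ hf hg

theorem TildeONat.coeff_X_mul {f : PowerSeries ℝ} {b : ℝ}
    (hf : TildeONat (fun N => PowerSeries.coeff N f) b) :
    TildeONat (fun N => PowerSeries.coeff N (PowerSeries.X * f)) b := by
  refine .of_succ ?_
  simpa only [PowerSeries.coeff_succ_X_mul] using hf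

/-! ### Tails -/

/-- The logarithmic weight grows more slowly than any power. -/
theorem logWeight_pow_le_rpow {a : ℝ} (ha : 0 < a) (c : ℕ) :
    ∃ K : ℝ, 0 < K ∧ ∀ m n : ℕ, m ≤ n → logWeight n ^ c ≤
      K * logWeight m ^ c * (((n : ℝ) + 1) / ((m : ℝ) + 1)) ^ a := by
  refine ⟨(1 + (c + 1) / a) ^ c, by positivity, fun m n hmn => ?_⟩
  set y : ℝ := ((n : ℝ) + 1) / ((m : ℝ) + 1) with hy
  have hmn' : (m : ℝ) ≤ n := by exact_mod_cast hmn
  have hy1 : 1 ≤ y := by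
    rw [hy, one_le_div (by positivity)]
    linarith
  have hlog : logWeight n = logWeight m + Real.log y := by
    rw [hy, Real.log_div (by positivity) (by positivity)]
    unfold logWeight
    ring
  have hm := one_le_logWeight m
  have h0 : 0 < a / (c + 1) := by positivity
  have h1 : Real.log y ≤ y ^ (a / (c + 1)) / (a / (c + 1)) :=
    Real.log_le_rpow_div (by linarith) h0
  have h2 : 1 ≤ y ^ (a / (c + 1)) := Real.one_le_rpow hy1 h0.le
  have h3 : logWeight n ≤ (1 + (c + 1) / a) * logWeight m * y ^ (a / (c + 1)) := by
    rw [hlog]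
    have e : y ^ (a / (c + 1)) / (a / (c + 1)) = (c + 1) / a * y ^ (a / (c + 1)) := by
      field_simp
    rw [e] at h1
    have hq : 0 < (c + 1) / a := by positivity
    calc logWeight m + Real.log y
        ≤ logWeight m * y ^ (a / (c + 1)) + (c + 1) / a * y ^ (a / (c + 1)) * logWeight m := by
          gcongr
          · nlinarith
          · exact h1.trans (le_mul_of_one_le_right (by positivity) hm)
      _ = _ := by ring
  calc logWeight n ^ c ≤ ((1 + (c + 1) / a) * logWeight m * y ^ (a / (c + 1))) ^ c := by
        have := logWeight_pos n
        gcongr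
    _ = (1 + (c + 1) / a) ^ c * logWeight m ^ c * y ^ (a / (c + 1) * c) := by
        rw [mul_pow, mul_pow, ← Real.rpow_mul_natCast (by linarith)]
    _ ≤ _ := by
        have := logWeight_pos m
        refine mul_le_mul_of_nonneg_left (Real.rpow_le_rpow_of_exponent_le hy1 ?_) (by positivity)
        rw [div_mul_eq_mul_div, div_le_iff₀ (by positivity)]
        nlinarith

/-- The bound that compares `∑ n ^ (-a-1)` with a telescoping sum. -/
theorem mul_rpow_le_rpow_sub_rpow {a x : ℝ} (ha : 0 < a) (hx : 0 < x) :
    a * (x + 1) ^ (-a - 1) ≤ x ^ (-a) - (x + 1) ^ (-a) := by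
  have hx1 : 0 < x + 1 := by linarith
  -- Bernoulli's inequality at `1 / x`.
  have h2 : 1 + a * (1 / (x + 1)) ≤ ((x + 1) / x) ^ a := by
    have := one_add_mul_self_le_rpow_one_add (s := 1 / x) (p := a + 1)
      (by have : 0 < 1 / x := by positivity
          linarith) (by linarith)
    have e : 1 + 1 / x = (x + 1) / x := by field_simp
    rw [e, Real.rpow_add_one (by positivity)] at this
    refine le_of_mul_le_mul_right (le_trans ?_ this) (show 0 < (x + 1) / x by positivity)
    have : (1 + a * (1 / (x + 1))) * ((x + 1) / x) = 1 + (a + 1) * (1 / x) := by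
      field_simp
      ring
    exact this.le
  have h3 : x ^ (-a) = ((x + 1) / x) ^ a * (x + 1) ^ (-a) := by
    rw [Real.div_rpow hx1.le hx.le, Real.rpow_neg hx.le, Real.rpow_neg hx1.le]
    field_simp
  rw [h3, Real.rpow_sub_one hx1.ne']
  have h4 : 0 < (x + 1) ^ (-a) := by positivity
  have : a * ((x + 1) ^ (-a) / (x + 1)) = (a * (1 / (x + 1))) * (x + 1) ^ (-a) := by ring
  rw [this]
  nlinarith

theorem sum_rpow_shift_le {a : ℝ} (ha : 0 < a) (n k : ℕ) :
    ∑ i ∈ Finset.range k, (((i + n + 1 : ℕ) : ℝ) + 1) ^ (-a - 1) ≤ ((n : ℝ) + 1) ^ (-a) / a := by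
  suffices h : ∑ i ∈ Finset.range k, (((i + n + 1 : ℕ) : ℝ) + 1) ^ (-a - 1) ≤
      (((n : ℝ) + 1) ^ (-a) - ((k : ℝ) + n + 1) ^ (-a)) / a by
    refine h.trans ?_
    gcongr
    linarith [Real.rpow_nonneg (show (0 : ℝ) ≤ (k : ℝ) + n + 1 by positivity) (-a)]
  induction k with
  | zero => simp
  | succ k ih =>
    rw [Finset.sum_range_succ]
    have := mul_rpow_le_rpow_sub_rpow ha (show (0 : ℝ) < (k : ℝ) + n + 1 by positivity)
    rw [le_div_iff₀ ha] at ih ⊢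
    push_cast at ih ⊢
    rw [show (k : ℝ) + 1 + n + 1 = (k : ℝ) + n + 1 + 1 by ring]
    nlinarith

theorem TildeONat.summable_abs {f : ℕ → ℝ} {κ : ℝ} (hκ : 0 < κ) (hf : TildeONat f (-κ - 1)) :
    Summable fun N => |f N| := by
  obtain ⟨C, c, hC, hf⟩ := tildeONat_iff.1 hf
  obtain ⟨K, hK, hlog⟩ := logWeight_pow_le_rpow (a := κ / 2) (by linarith) c
  have hs : Summable fun N : ℕ => (((N + 1 : ℕ) : ℝ)) ^ (-(κ / 2) - 1) :=
    (summable_nat_add_iff 1).2 (Real.summable_nat_rpow.2 (by linarith))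
  refine Summable.of_nonneg_of_le (fun _ => abs_nonneg _) (fun N => ?_) (hs.mul_left (C * K))
  refine (hf N).trans ?_
  have := hlog 0 N (Nat.zero_le _)
  simp only [logWeight, Nat.cast_zero, zero_add, Real.log_one, add_zero, one_pow, mul_one,
    div_one] at this
  rw [mul_assoc]
  push_cast
  have e : ((N : ℝ) + 1) ^ (-(κ / 2) - 1) =
      ((N : ℝ) + 1) ^ (-κ - 1) * ((N : ℝ) + 1) ^ (κ / 2) := by
    rw [← Real.rpow_add (by positivity)]
    ring_nf
  rw [e]
  calc _ ≤ C * (((N : ℝ) + 1) ^ (-κ - 1) * (K * ((N : ℝ) + 1) ^ (κ / 2))) := by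
        gcongr
        exact this
    _ = _ := by ring

/-- The tails of a summable `Õ` sequence. -/
theorem TildeONat.tail {f : ℕ → ℝ} {κ : ℝ} (hκ : 0 < κ) (hf : TildeONat f (-κ - 1)) :
    TildeONat (fun N => ∑' i, f (i + N + 1)) (-κ) := by
  obtain ⟨C, c, hC, hf⟩ := tildeONat_iff.1 hf
  obtain ⟨K, hK, hlog⟩ := logWeight_pow_le_rpow (a := κ / 2) (by linarith) c
  refine tildeONat_iff.2 ⟨C * K * (2 / κ), c, by positivity, fun N => ?_⟩
  have hN := logWeight_pos N
  rw [← Real.norm_eq_abs]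
  have hb : ∀ i, ‖f (i + N + 1)‖ ≤ C * K * logWeight N ^ c * ((N : ℝ) + 1) ^ (-(κ / 2)) *
      (((i + N + 1 : ℕ) : ℝ) + 1) ^ (-(κ / 2) - 1) := by
    intro i
    refine (hf _).trans ?_
    have h := hlog N (i + N + 1) (by omega)
    set y : ℝ := ((i + N + 1 : ℕ) : ℝ) + 1
    have hy : 0 < y := by positivity
    have hN1 : (0 : ℝ) < (N : ℝ) + 1 := by positivity
    have e : y ^ (-(κ / 2) - 1) = y ^ (-κ - 1) * y ^ (κ / 2) := by
      rw [← Real.rpow_add hy]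
      ring_nf
    rw [Real.div_rpow hy.le hN1.le, div_eq_mul_inv, ← Real.rpow_neg hN1.le] at h
    rw [e]
    calc _ ≤ C * (y ^ (-κ - 1) * (K * logWeight N ^ c * (y ^ (κ / 2) *
          ((N : ℝ) + 1) ^ (-(κ / 2))))) := by gcongr
      _ = _ := by ring
  have hsum : ∀ k, ∑ i ∈ Finset.range k, ‖f (i + N + 1)‖ ≤
      C * K * (2 / κ) * (((N : ℝ) + 1) ^ (-κ) * logWeight N ^ c) := by
    intro k
    refine (Finset.sum_le_sum fun i _ => hb i).trans ?_
    rw [← Finset.mul_sum]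
    have e : ((N : ℝ) + 1) ^ (-κ) = ((N : ℝ) + 1) ^ (-(κ / 2)) * ((N : ℝ) + 1) ^ (-(κ / 2)) := by
      rw [← Real.rpow_add (by positivity)]
      ring_nf
    rw [e]
    calc _ ≤ C * K * logWeight N ^ c * ((N : ℝ) + 1) ^ (-(κ / 2)) *
          (((N : ℝ) + 1) ^ (-(κ / 2)) / (κ / 2)) := by
          gcongr
          exact sum_rpow_shift_le (by linarith) N k
      _ = _ := by ring
  have hs := summable_of_sum_range_le (fun i => norm_nonneg _) hsum
  exact (norm_tsum_le_tsum_norm hs).trans (hs.tsum_le_of_sum_range_le hsum)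

/-! ### The powers of `1 - X` -/

/-- The formal power series `(1 - X) ^ (-β)`. -/
def invPow (β : ℝ) : PowerSeries ℝ :=
  PowerSeries.rescale (-1) (PowerSeries.binomialSeries ℝ (-β))

theorem coeff_invPow (β : ℝ) (n : ℕ) :
    PowerSeries.coeff n (invPow β) = (-1) ^ n * Ring.choose (-β) n := by
  simp [invPow, PowerSeries.coeff_rescale]

theorem coeff_zero_invPow (β : ℝ) : PowerSeries.coeff 0 (invPow β) = 1 := by
  simp [coeff_invPow]

theorem invPow_add (β γ : ℝ) : invPow (β + γ) = invPow β * invPow γ := by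
  rw [invPow, neg_add, PowerSeries.binomialSeries_add, map_mul, invPow, invPow]

theorem invPow_zero : invPow 0 = 1 := by
  rw [invPow, neg_zero, PowerSeries.binomialSeries_zero, map_one]

theorem invPow_neg_one : invPow (-1) = 1 - PowerSeries.X := by
  have h := PowerSeries.binomialSeries_nat (R := ℝ) (A := ℝ) 1
  rw [invPow, neg_neg]
  simp only [Nat.cast_one, pow_one] at h
  rw [h, map_add, map_one, PowerSeries.rescale_X]
  simp [sub_eq_add_neg]

theorem coeff_succ_invPow (β : ℝ) (n : ℕ) :
    ((n : ℝ) + 1) * PowerSeries.coeff (n + 1) (invPow β) =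
      (β + n) * PowerSeries.coeff n (invPow β) := by
  have h := Ring.choose_smul_choose (-β) (Nat.le_succ n)
  rw [Nat.succ_eq_add_one, Nat.choose_succ_self_right, Nat.add_sub_cancel_left,
    Ring.choose_one_right, nsmul_eq_mul] at h
  push_cast at h
  rw [coeff_invPow, coeff_invPow, pow_succ]
  linear_combination (-(-1) ^ n) * h

theorem hasSum_invPow (β : ℝ) {z : ℂ} (hz : ‖z‖ < 1) :
    HasSum (fun N : ℕ => ((PowerSeries.coeff N (invPow β) : ℝ) : ℂ) * z ^ N)
      ((1 - z) ^ ((-β : ℝ) : ℂ)) := by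
  have h := (Complex.one_add_cpow_hasFPowerSeriesOnBall_zero (a := ((-β : ℝ) : ℂ))).hasSum
    (y := -z) (by simpa [Metric.mem_eball, edist_zero_right, enorm_eq_nnnorm] using! hz)
  simp only [binomialSeries_apply, zero_add] at h
  rw [← sub_eq_add_neg] at h
  convert! h using 2 with N
  rw [coeff_invPow, List.ofFn_const, List.prod_replicate, smul_eq_mul, ← Complex.ofReal_choose,
    neg_pow z]
  push_cast
  ring

/-! ### Asymptotics of the coefficients of `(1 - X) ^ (-β)` -/

/-- The first order Taylor terms of `(1 - x) ^ a` and `1 + a x` cancel. -/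
theorem abs_one_sub_rpow_mul_sub_one_le (a : ℝ) {x : ℝ} (hx0 : 0 ≤ x) (hx : x ≤ 1 / 2) :
    |(1 - x) ^ a * (1 + a * x) - 1| ≤ |a * (a + 1)| * 2 ^ |a - 1| * x ^ 2 := by
  have hd : ∀ y ∈ Set.Icc (0 : ℝ) x, HasDerivWithinAt (fun y => (1 - y) ^ a * (1 + a * y))
      (-(a * (a + 1)) * y * (1 - y) ^ (a - 1)) (Set.Icc 0 x) y := by
    intro y hy
    have hy1 : 0 < 1 - y := by linarith [hy.2]
    have h1 : HasDerivAt (fun y : ℝ => (1 - y) ^ a) ((0 - 1) * a * (1 - y) ^ (a - 1)) y :=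
      ((hasDerivAt_const y (1 : ℝ)).sub (hasDerivAt_id y)).rpow_const (Or.inl hy1.ne')
    have h2 : HasDerivAt (fun y : ℝ => 1 + a * y) (a * 1) y :=
      ((hasDerivAt_id y).const_mul a).const_add 1
    have h := (h1.mul h2).hasDerivWithinAt (s := Set.Icc 0 x)
    refine h.congr_deriv ?_
    have e : (1 - y) ^ a = (1 - y) ^ (a - 1) * (1 - y) := by
      rw [← Real.rpow_add_one hy1.ne']
      ring_nf
    rw [e]
    ring
  have hb : ∀ y ∈ Set.Icc (0 : ℝ) x, ‖-(a * (a + 1)) * y * (1 - y) ^ (a - 1)‖ ≤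
      |a * (a + 1)| * 2 ^ |a - 1| * x := by
    intro y hy
    have hy1 : 0 < 1 - y := by linarith [hy.2]
    have h1 : (1 - y) ^ (a - 1) ≤ 2 ^ |a - 1| * 1 ^ (a - 1) :=
      rpow_le_of_comparable hy1 one_pos (by norm_num) (by linarith [hy.1]) (by linarith [hy.2]) _
    rw [Real.one_rpow, mul_one] at h1
    rw [norm_mul, norm_mul, norm_neg, Real.norm_eq_abs, Real.norm_of_nonneg hy.1,
      Real.norm_of_nonneg (by positivity)]
    have := hy.2
    have := hy.1
    calc |a * (a + 1)| * y * (1 - y) ^ (a - 1) ≤ |a * (a + 1)| * x * 2 ^ |a - 1| := by gcongr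
      _ = _ := by ring
  have h := (convex_Icc (0 : ℝ) x).norm_image_sub_le_of_norm_hasDerivWithin_le hd hb
    (Set.left_mem_Icc.2 hx0) (Set.right_mem_Icc.2 hx0)
  simp only [sub_zero, Real.one_rpow, mul_zero, add_zero, mul_one] at h
  rw [Real.norm_eq_abs, Real.norm_of_nonneg hx0] at h
  linarith

/-- The coefficients of `(1 - X) ^ (-β)`, rescaled so as to converge. -/
def scaledCoeff (β : ℝ) (n : ℕ) : ℝ :=
  PowerSeries.coeff n (invPow β) * (n : ℝ) ^ (1 - β)

theorem scaledCoeff_succ (β : ℝ) {n : ℕ} (hn : 1 ≤ n) :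
    scaledCoeff β (n + 1) = scaledCoeff β n *
      ((1 - 1 / ((n : ℝ) + 1)) ^ (β - 1) * (1 + (β - 1) * (1 / ((n : ℝ) + 1)))) := by
  have hn0 : (0 : ℝ) < n := by exact_mod_cast hn
  have hn1 : (0 : ℝ) < (n : ℝ) + 1 := by positivity
  have h := coeff_succ_invPow β n
  have e1 : 1 - 1 / ((n : ℝ) + 1) = n / (n + 1) := by
    field_simp
    ring
  have e2 : PowerSeries.coeff (n + 1) (invPow β) =
      (β + n) * PowerSeries.coeff n (invPow β) / (n + 1) := by
    rw [← h]
    field_simp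
  unfold scaledCoeff
  rw [e1, e2, Real.div_rpow hn0.le hn1.le, show β - 1 = -(1 - β) by ring, Real.rpow_neg hn0.le,
    Real.rpow_neg hn1.le]
  push_cast
  have p1 : 0 < (n : ℝ) ^ (1 - β) := by positivity
  have p2 : 0 < ((n : ℝ) + 1) ^ (1 - β) := by positivity
  field_simp
  ring

theorem coeff_invPow_eq_prod (β : ℝ) (n : ℕ) :
    PowerSeries.coeff n (invPow β) * n.factorial = ∏ j ∈ Finset.range n, (β + j) := by
  induction n with
  | zero => simp [coeff_zero_invPow]
  | succ n ih =>
    rw [Finset.prod_range_succ, ← ih, Nat.factorial_succ]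
    push_cast
    linear_combination (n.factorial : ℝ) * coeff_succ_invPow β n

theorem tendsto_scaledCoeff {β : ℝ} (hΓ : Real.Gamma β ≠ 0) :
    Tendsto (scaledCoeff β) atTop (𝓝 (Real.Gamma β)⁻¹) := by
  have h1 := (Real.GammaSeq_tendsto_Gamma β).inv₀ hΓ
  have h2 : Tendsto (fun n : ℕ => (n : ℝ) / (n + β)) atTop (𝓝 1) :=
    tendsto_natCast_div_add_atTop β
  have h3 := h1.mul h2
  rw [mul_one] at h3
  refine h3.congr' ?_
  filter_upwards [eventually_ge_atTop 1, eventually_gt_atTop ⌈-β⌉₊] with n hn hn2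
  have hn0 : (0 : ℝ) < n := by exact_mod_cast hn
  have hnβ : (n : ℝ) + β ≠ 0 := by
    have : -β < n := (Nat.le_ceil _).trans_lt (by exact_mod_cast hn2)
    linarith
  have hf : (n.factorial : ℝ) ≠ 0 := by exact_mod_cast n.factorial_ne_zero
  rw [Real.GammaSeq, Finset.prod_range_succ, ← coeff_invPow_eq_prod, scaledCoeff,
    Real.rpow_sub hn0, Real.rpow_one, inv_div, add_comm β]
  field_simp

theorem coeff_invPow_eq_zero {β : ℝ} (m : ℕ) (hβ : β = -m) {n : ℕ} (hn : m < n) :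
    PowerSeries.coeff n (invPow β) = 0 := by
  have h := coeff_invPow_eq_prod β n
  rw [Finset.prod_eq_zero (Finset.mem_range.2 hn) (by rw [hβ]; ring)] at h
  exact (mul_eq_zero.1 h).resolve_right (by exact_mod_cast n.factorial_ne_zero)

theorem tildeONat_scaledCoeff_succ_sub {β : ℝ} (hΓ : Real.Gamma β ≠ 0) :
    TildeONat (fun n => scaledCoeff β (n + 1) - scaledCoeff β n) (-1 - 1) := by
  have hlim := tendsto_scaledCoeff hΓ
  obtain ⟨B, hB⟩ := hlim.norm.bddAbove_range
  refine .of_isBigO (IsBigO.of_bound (B * (|(β - 1) * (β - 1 + 1)| * 2 ^ |β - 1 - 1|)) ?_)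
  filter_upwards [eventually_ge_atTop 1] with n hn
  have hn0 : (1 : ℝ) ≤ n := by exact_mod_cast hn
  have hBn : ‖scaledCoeff β n‖ ≤ B := hB ⟨n, rfl⟩
  have hB0 : 0 ≤ B := (norm_nonneg _).trans hBn
  have hx := abs_one_sub_rpow_mul_sub_one_le (β - 1) (x := 1 / ((n : ℝ) + 1)) (by positivity)
    (by rw [div_le_div_iff₀ (by positivity) (by norm_num)]; linarith)
  have e : (n : ℝ) ^ (-1 - 1 : ℝ) = (1 / (n : ℝ)) ^ 2 := by
    rw [show (-1 - 1 : ℝ) = -(2 : ℕ) by norm_num, Real.rpow_neg (by linarith),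
      Real.rpow_natCast]
    simp
  rw [scaledCoeff_succ β hn, ← mul_sub_one, norm_mul, Real.norm_eq_abs (_ - 1), e,
    Real.norm_of_nonneg (sq_nonneg (1 / (n : ℝ))), mul_assoc]
  refine mul_le_mul hBn (hx.trans ?_) (abs_nonneg _) hB0
  gcongr
  linarith

/-- The tail of a telescoping series of size `Õ(N ^ (-κ-1))` is the distance from the limit. -/
theorem TildeONat.sub_limit {v : ℕ → ℝ} {κ L : ℝ} (hκ : 0 < κ) (hv : Tendsto v atTop (𝓝 L))
    (hd : TildeONat (fun n => v (n + 1) - v n) (-κ - 1)) :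
    TildeONat (fun n => v n - L) (-κ) := by
  have ht := hd.tail hκ
  have hs : Summable fun n => v (n + 1) - v n := summable_abs_iff.1 (hd.summable_abs hκ)
  have key : ∀ n, ∑' i, (v (i + n + 1 + 1) - v (i + n + 1)) = L - v (n + 1) := by
    intro n
    have hs' : Summable fun i => v (i + n + 1 + 1) - v (i + n + 1) :=
      (summable_nat_add_iff (f := fun i => v (i + 1) - v i) (n + 1)).2 hs
    refine tendsto_nhds_unique hs'.hasSum.tendsto_sum_nat ?_
    have h1 : Tendsto (fun k => v (k + n + 1)) atTop (𝓝 L) :=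
      (tendsto_add_atTop_iff_nat (f := v) (n + 1)).2 hv
    refine (h1.sub_const (v (n + 1))).congr fun k => ?_
    have := Finset.sum_range_sub (fun i => v (i + n + 1)) k
    simp only [zero_add] at this
    rw [← this]
    refine Finset.sum_congr rfl fun i _ => ?_
    rw [add_right_comm i 1 n]
  refine TildeONat.of_succ (ht.neg.congr' (Eventually.of_forall fun n => ?_))
  simp only [key, neg_sub]

theorem tildeONat_scaledCoeff_sub {β : ℝ} (hΓ : Real.Gamma β ≠ 0) :
    TildeONat (fun n => scaledCoeff β n - (Real.Gamma β)⁻¹) (-1) :=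
  .sub_limit one_pos (tendsto_scaledCoeff hΓ) (tildeONat_scaledCoeff_succ_sub hΓ)

theorem tildeONat_coeff_invPow_sub {β : ℝ} :
    TildeONat (fun N => PowerSeries.coeff N (invPow β) - (Real.Gamma β)⁻¹ * (N : ℝ) ^ (β - 1))
      (β - 2) := by
  by_cases hΓ : Real.Gamma β = 0
  · obtain ⟨m, hm⟩ := (Real.Gamma_eq_zero_iff β).1 hΓ
    refine (tildeONat_zero _).congr' ?_
    filter_upwards [eventually_gt_atTop m] with n hn
    rw [coeff_invPow_eq_zero m hm hn, hΓ]
    simp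
  · have h := (tildeONat_scaledCoeff_sub hΓ).mul (tildeONat_rpow (β - 1))
    rw [show -1 + (β - 1) = β - 2 by ring] at h
    refine h.congr' ?_
    filter_upwards [eventually_ge_atTop 1] with n hn
    have hn0 : (0 : ℝ) < n := by exact_mod_cast hn
    rw [scaledCoeff, sub_mul, mul_assoc, ← Real.rpow_add hn0]
    simp

theorem tildeONat_coeff_invPow (β : ℝ) :
    TildeONat (fun N => PowerSeries.coeff N (invPow β)) (β - 1) := by
  have h := (tildeONat_coeff_invPow_sub (β := β)).mono (show β - 2 ≤ β - 1 by linarith)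
  simpa using h.add ((tildeONat_rpow (β - 1)).const_mul (Real.Gamma β)⁻¹)

/-! ### From coefficients to the behaviour at `z = 1` -/

theorem sum_range_pow_mul_geometric_le (m k : ℕ) {r : ℝ} (hr0 : 0 ≤ r) (hr1 : r < 1) :
    ∑ N ∈ Finset.range k, ((N : ℝ) + 1) ^ m * r ^ N ≤ m.factorial * (1 / (1 - r)) ^ (m + 1) := by
  have h := hasSum_choose_mul_geometric_of_norm_lt_one (𝕜 := ℝ) m
    (r := r) (by rwa [Real.norm_of_nonneg hr0])
  have hle := sum_le_hasSum (Finset.range k) (fun N _ => by positivity) h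
  rw [one_div_pow]
  refine le_trans ?_ (mul_le_mul_of_nonneg_left hle (by positivity))
  rw [Finset.mul_sum]
  refine Finset.sum_le_sum fun N _ => ?_
  rw [← mul_assoc]
  gcongr
  have h1 := Nat.pow_succ_le_ascFactorial (N + 1) m
  rw [Nat.ascFactorial_eq_factorial_mul_choose] at h1
  exact_mod_cast h1

/-- The terms up to `N ≈ 1 / (1 - r)` contribute at most a harmonic sum, the later ones at most a
derivative of the geometric series. -/
theorem sum_range_weight_mul_geometric_le {β : ℝ} (hβ : 0 ≤ β) (c : ℕ) :
    ∃ K : ℝ, 0 < K ∧ ∀ r : ℝ, 0 ≤ r → r < 1 → ∀ k : ℕ,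
      ∑ N ∈ Finset.range k, ((N : ℝ) + 1) ^ (β - 1) * logWeight N ^ c * r ^ N ≤
        K * ((1 / (1 - r)) ^ β * (1 + Real.log (1 / (1 - r))) ^ (c + 1)) := by
  set m : ℕ := ⌈β⌉₊ + c
  refine ⟨1 + m.factorial, by positivity, fun r hr0 hr1 k => ?_⟩
  set x : ℝ := 1 / (1 - r) with hxdef
  have hx1 : 1 ≤ x := by
    rw [hxdef, one_le_div (by linarith)]
    linarith
  have hx0 : 0 < x := by linarith
  have hl0 : 0 ≤ Real.log x := Real.log_nonneg hx1
  have hl1 : 1 ≤ 1 + Real.log x := by linarith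
  set l : ℝ := 1 + Real.log x
  have hterm : ∀ N ∈ Finset.range k, ((N : ℝ) + 1) ^ (β - 1) * logWeight N ^ c * r ^ N ≤
      x ^ β * l ^ c * (if (N : ℝ) + 1 ≤ x then 1 / ((N : ℝ) + 1) else 0) +
        x ^ (β - 1) * l ^ c / x ^ m * (((N : ℝ) + 1) ^ m * r ^ N) := by
    intro N _
    have hN0 : (0 : ℝ) < (N : ℝ) + 1 := by positivity
    have hw := logWeight_pos N
    split_ifs with hN
    · refine le_add_of_le_of_nonneg ?_ (by positivity)
      have h1 : logWeight N ≤ l := by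
        have := Real.log_le_log hN0 hN
        simp only [logWeight, l]
        linarith
      have h2 : ((N : ℝ) + 1) ^ (β - 1) ≤ x ^ β * (1 / ((N : ℝ) + 1)) := by
        rw [Real.rpow_sub_one hN0.ne', div_eq_mul_one_div]
        gcongr
      calc _ ≤ (x ^ β * (1 / ((N : ℝ) + 1))) * l ^ c * 1 := by
            gcongr
            exact pow_le_one₀ hr0 hr1.le
        _ = _ := by ring
    · rw [mul_zero, zero_add]
      push Not at hN
      set y : ℝ := ((N : ℝ) + 1) / x with hy
      have hy1 : 1 ≤ y := by
        rw [hy, one_le_div hx0]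
        exact hN.le
      have hNy : (N : ℝ) + 1 = x * y := by
        rw [hy]
        field_simp
      have h1 : logWeight N ≤ l * y := by
        have : Real.log y ≤ y - 1 := Real.log_le_sub_one_of_pos (by linarith)
        rw [logWeight, hNy, Real.log_mul hx0.ne' (by linarith)]
        simp only [l]
        nlinarith
      have h2 : y ^ (β - 1) ≤ y ^ (⌈β⌉₊ : ℕ) := by
        rw [← Real.rpow_natCast]
        exact Real.rpow_le_rpow_of_exponent_le hy1 (by linarith [Nat.le_ceil β])
      rw [hNy, Real.mul_rpow hx0.le (by linarith)]
      calc _ ≤ x ^ (β - 1) * y ^ (⌈β⌉₊ : ℕ) * (l * y) ^ c * r ^ N := by gcongr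
        _ = _ := by
          rw [mul_pow, mul_pow, pow_add y]
          field_simp
  refine (Finset.sum_le_sum hterm).trans ?_
  rw [Finset.sum_add_distrib, ← Finset.mul_sum, ← Finset.mul_sum]
  have hs1 : ∑ N ∈ Finset.range k, (if (N : ℝ) + 1 ≤ x then 1 / ((N : ℝ) + 1) else 0) ≤ l := by
    rw [← Finset.sum_filter]
    have hsub : (Finset.range k).filter (fun N : ℕ => (N : ℝ) + 1 ≤ x) ⊆
        Finset.range (⌊x⌋₊ - 1 + 1) := by
      intro N hN
      rw [Finset.mem_filter] at hN
      have : N + 1 ≤ ⌊x⌋₊ := Nat.le_floor (by push_cast; exact hN.2)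
      rw [Finset.mem_range]
      omega
    refine (Finset.sum_le_sum_of_subset_of_nonneg hsub fun _ _ _ => by positivity).trans ?_
    refine (sum_inv_succ_le_logWeight _).trans ?_
    have hf : 1 ≤ ⌊x⌋₊ := (Nat.one_le_floor_iff x).2 hx1
    simp only [logWeight, l]
    gcongr
    have := Nat.floor_le hx0.le
    rw [Nat.cast_sub hf]
    push_cast
    linarith
  calc _ ≤ x ^ β * l ^ c * l + x ^ (β - 1) * l ^ c / x ^ m * (m.factorial * x ^ (m + 1)) := by
        gcongr
        exact sum_range_pow_mul_geometric_le m k hr0 hr1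
    _ = x ^ β * l ^ (c + 1) + m.factorial * (x ^ β * l ^ c) := by
        rw [Real.rpow_sub_one hx0.ne']
        field_simp
        ring
    _ ≤ x ^ β * l ^ (c + 1) + m.factorial * (x ^ β * l ^ (c + 1)) := by
        gcongr
        omega
    _ = _ := by ring

theorem TildeONat.norm_tsum_le {f : ℕ → ℝ} {β : ℝ} (hβ : 0 ≤ β) (hf : TildeONat f (β - 1)) :
    ∃ C : ℝ, ∃ c : ℕ, 0 < C ∧ ∀ z : ℂ, ‖z‖ < 1 →
      Summable (fun N => (f N : ℂ) * z ^ N) ∧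
        ‖∑' N, (f N : ℂ) * z ^ N‖ ≤
          C * ((1 / (1 - ‖z‖)) ^ β * (1 + Real.log (1 / (1 - ‖z‖))) ^ c) := by
  obtain ⟨C, c, hC, hf⟩ := tildeONat_iff.1 hf
  obtain ⟨K, hK, hs⟩ := sum_range_weight_mul_geometric_le hβ c
  refine ⟨C * K, c + 1, by positivity, fun z hz => ?_⟩
  have hsum : ∀ k, ∑ N ∈ Finset.range k, ‖(f N : ℂ) * z ^ N‖ ≤
      C * K * ((1 / (1 - ‖z‖)) ^ β * (1 + Real.log (1 / (1 - ‖z‖))) ^ (c + 1)) := by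
    intro k
    rw [mul_assoc]
    refine le_trans ?_ (mul_le_mul_of_nonneg_left (hs ‖z‖ (norm_nonneg z) hz k) hC.le)
    rw [Finset.mul_sum]
    refine Finset.sum_le_sum fun N _ => ?_
    rw [norm_mul, norm_pow, Complex.norm_real, Real.norm_eq_abs]
    calc |f N| * ‖z‖ ^ N ≤ (C * (((N : ℝ) + 1) ^ (β - 1) * logWeight N ^ c)) * ‖z‖ ^ N := by
          gcongr
          exact hf N
      _ = _ := by ring
  have hsm := summable_of_sum_range_le (fun i => norm_nonneg _) hsum
  exact ⟨hsm.of_norm, (norm_tsum_le_tsum_norm hsm).trans (hsm.tsum_le_of_sum_range_le hsum)⟩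

theorem TildeONat.summable_mul_pow {f : ℕ → ℝ} {b : ℝ} (hf : TildeONat f b) {z : ℂ}
    (hz : ‖z‖ < 1) : Summable fun N => (f N : ℂ) * z ^ N := by
  have h : TildeONat f (max (b + 1) 0 - 1) := hf.mono (by linarith [le_max_left (b + 1) 0])
  obtain ⟨C, c, -, h⟩ := h.norm_tsum_le (le_max_right _ _)
  exact (h z hz).1

/-- Inside a Stolz angle, `1 - ‖z‖` and `‖1 - z‖` are comparable. -/
theorem TildeO.of_norm_le {f : ℂ → ℂ} {β C : ℝ} {c : ℕ} (hβ : 0 ≤ β) (hC : 0 < C)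
    (h : ∀ z : ℂ, ‖z‖ < 1 →
      ‖f z‖ ≤ C * ((1 / (1 - ‖z‖)) ^ β * (1 + Real.log (1 / (1 - ‖z‖))) ^ c)) :
    TildeO f (-β) := by
  refine ⟨c, fun M => ?_⟩
  rcases le_or_gt M 1 with hM | hM
  · rw [Complex.stolzSet_empty hM]
    simp
  refine IsBigO.of_bound (C * (M ^ β * (2 + Real.log M) ^ c)) ?_
  have hnear : ∀ᶠ z : ℂ in 𝓝[Complex.stolzSet M] 1, ‖1 - z‖ < Real.exp (-1) := by
    have : Tendsto (fun z : ℂ => ‖1 - z‖) (𝓝 1) (𝓝 0) := by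
      have h : Continuous fun z : ℂ => ‖1 - z‖ := by fun_prop
      simpa using h.tendsto 1
    exact (this.mono_left nhdsWithin_le_nhds).eventually (gt_mem_nhds (Real.exp_pos _))
  filter_upwards [hnear, self_mem_nhdsWithin] with z hz1 hz
  obtain ⟨hz2, hz3⟩ := hz
  set d : ℝ := ‖1 - z‖ with hd
  have hd0 : 0 < d := by
    rw [hd, norm_pos_iff, sub_ne_zero]
    rintro rfl
    simp at hz2
  have hM0 : 0 < M := by linarith
  have hlM : 0 ≤ Real.log M := Real.log_nonneg hM.le
  have hld : Real.log d < -1 := by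
    rw [Real.log_lt_iff_lt_exp hd0]
    exact hz1
  set x : ℝ := 1 / (1 - ‖z‖) with hx
  have hx0 : 0 < 1 - ‖z‖ := by linarith
  have hx1 : 1 ≤ x := by
    rw [hx, one_le_div hx0]
    linarith [norm_nonneg z]
  have hxM : x ≤ M / d := by
    rw [hx, div_le_div_iff₀ hx0 hd0]
    linarith
  have hl : 1 + Real.log x ≤ (2 + Real.log M) * |Real.log d| := by
    have := Real.log_le_log (by linarith) hxM
    rw [Real.log_div hM0.ne' hd0.ne'] at this
    rw [abs_of_neg (by linarith)]
    nlinarith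
  have hxb : x ^ β ≤ M ^ β * d ^ (-β) := by
    refine (Real.rpow_le_rpow (by linarith) hxM hβ).trans ?_
    rw [Real.div_rpow hM0.le hd0.le, Real.rpow_neg hd0.le, div_eq_mul_inv]
  have hlx : 0 ≤ 1 + Real.log x := by linarith [Real.log_nonneg hx1]
  rw [Real.norm_of_nonneg (show 0 ≤ d ^ (-β) * |Real.log d| ^ c by positivity)]
  calc ‖f z‖ ≤ C * (x ^ β * (1 + Real.log x) ^ c) := h z hz2
    _ ≤ C * ((M ^ β * d ^ (-β)) * ((2 + Real.log M) * |Real.log d|) ^ c) := by gcongr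
    _ = _ := by rw [mul_pow]; ring

theorem TildeONat.tildeO_tsum {f : ℕ → ℝ} {κ : ℝ} (hκ : κ ≤ 0) (hf : TildeONat f (-κ - 1)) :
    TildeO (fun z => ∑' N, (f N : ℂ) * z ^ N) κ := by
  obtain ⟨C, c, hC, h⟩ := hf.norm_tsum_le (show 0 ≤ -κ by linarith)
  simpa using TildeO.of_norm_le (by linarith) hC fun z hz => (h z hz).2

theorem TildeO.congr {f g : ℂ → ℂ} {b : ℝ} (hf : TildeO f b)
    (hfg : ∀ z : ℂ, ‖z‖ < 1 → f z = g z) : TildeO g b := by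
  obtain ⟨c, hf⟩ := hf
  refine ⟨c, fun M => (hf M).congr' ?_ EventuallyEq.rfl⟩
  filter_upwards [self_mem_nhdsWithin] with z hz
  exact hfg z hz.1

theorem TildeO.one_sub_mul {f : ℂ → ℂ} {b : ℝ} (hf : TildeO f b) :
    TildeO (fun z => (1 - z) * f z) (b + 1) := by
  obtain ⟨c, hf⟩ := hf
  refine ⟨c, fun M => ?_⟩
  have h := (isBigO_refl (fun z : ℂ => 1 - z) (𝓝[Complex.stolzSet M] 1)).norm_right.mul (hf M)
  refine h.congr' EventuallyEq.rfl ?_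
  filter_upwards [self_mem_nhdsWithin] with z hz
  have hd0 : ‖1 - z‖ ≠ 0 := by
    rw [norm_ne_zero_iff, sub_ne_zero]
    rintro rfl
    simpa using hz.1
  rw [Real.rpow_add_one hd0]
  ring

/-- Partial summation of a power series at its value at `1`. -/
theorem tsum_mul_pow_eq_tsum_add {f : ℕ → ℝ} {κ : ℝ} (hκ : 0 < κ) (hf : TildeONat f (-κ - 1))
    {z : ℂ} (hz : ‖z‖ < 1) :
    ∑' N, (f N : ℂ) * z ^ N =
      ((∑' N, f N : ℝ) : ℂ) - (1 - z) * ∑' N, ((∑' i, f (i + N + 1) : ℝ) : ℂ) * z ^ N := by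
  have hs : Summable f := summable_abs_iff.1 (hf.summable_abs hκ)
  have hsT := (hf.tail hκ).summable_mul_pow hz
  have hsf := hf.summable_mul_pow hz
  set T : ℕ → ℝ := fun N => ∑' i, f (i + N + 1) with hT
  have hT0 : f 0 + T 0 = ∑' N, f N := by
    rw [hT, hs.tsum_eq_zero_add]
  have hTs : ∀ N, T N = f (N + 1) + T (N + 1) := by
    intro N
    have h1 : Summable fun i => f (i + N + 1) := (summable_nat_add_iff (f := f) (N + 1)).2 hs
    simp only [hT]
    rw [h1.tsum_eq_zero_add]
    simp only [zero_add]
    congr 1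
    refine tsum_congr fun i => ?_
    ring_nf
  have hsT1 : Summable fun N => (T (N + 1) : ℂ) * z ^ (N + 1) :=
    (summable_nat_add_iff (f := fun N => (T N : ℂ) * z ^ N) 1).2 hsT
  have e1 : ∑' N, (T N : ℂ) * z ^ N = T 0 + ∑' N, (T (N + 1) : ℂ) * z ^ (N + 1) := by
    have := hsT.tsum_eq_zero_add
    simpa only [pow_zero, mul_one] using this
  have e2 : z * ∑' N, (T N : ℂ) * z ^ N =
      ∑' N, (f (N + 1) : ℂ) * z ^ (N + 1) + ∑' N, (T (N + 1) : ℂ) * z ^ (N + 1) := by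
    rw [← Summable.tsum_add ((summable_nat_add_iff (f := fun N => (f N : ℂ) * z ^ N) 1).2 hsf)
      hsT1, ← tsum_mul_left]
    refine tsum_congr fun N => ?_
    rw [hTs N]
    push_cast
    ring
  rw [hsf.tsum_eq_zero_add, ← hT0, sub_mul, one_mul, e2, e1]
  push_cast
  ring

/-- Coefficients of size `Õ(N ^ (-κ-1))` determine the function up to `Õ((1-z) ^ κ)`, except for a
constant, which is the sum of the coefficients when `κ > 0`. -/
theorem TildeONat.exists_tildeO_tsum_sub {f : ℕ → ℝ} {κ : ℝ} (hκ : κ < 1)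
    (hf : TildeONat f (-κ - 1)) :
    ∃ a : ℝ, TildeO (fun z => ∑' N, (f N : ℂ) * z ^ N - a) κ ∧ (0 < κ → a = ∑' N, f N) := by
  rcases le_or_gt κ 0 with h0 | h0
  · exact ⟨0, by simpa using hf.tildeO_tsum h0, fun h => absurd h h0.not_gt⟩
  · refine ⟨∑' N, f N, ?_, fun _ => rfl⟩
    have hT := (hf.tail h0).neg
    rw [show -κ = -(κ - 1) - 1 by ring] at hT
    have h := (hT.tildeO_tsum (by linarith)).one_sub_mul
    rw [sub_add_cancel] at h
    refine h.congr fun z hz => ?_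
    rw [tsum_mul_pow_eq_tsum_add h0 hf hz]
    push_cast
    simp only [neg_mul, tsum_neg]
    ring

/-- A constant of size `Õ((1-z) ^ κ)` with `κ > 0` vanishes. -/
theorem eq_zero_of_tildeO_const {a : ℂ} {κ : ℝ} (hκ : 0 < κ) (h : TildeO (fun _ => a) κ) :
    a = 0 := by
  obtain ⟨c, h⟩ := h
  have h2 := (h 2).comp_tendsto (tendsto_id.mono_left
    (Complex.nhdsWithin_lt_le_nhdsWithin_stolzSet one_lt_two))
  have h3 : Tendsto (fun x : ℝ => (1 - x) ^ κ * |Real.log (1 - x)| ^ c) (𝓝[<] 1) (𝓝 0) := by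
    have h4 : Tendsto (fun x : ℝ => x ^ κ * |Real.log x| ^ c) (𝓝[>] 0) (𝓝 0) := by
      have h5 := tendsto_log_mul_rpow_nhdsGT_zero (r := κ / (c + 1)) (by positivity)
      have h6 := (h5.abs.pow c)
      have h7 : Tendsto (fun x : ℝ => x ^ (κ / (c + 1))) (𝓝[>] 0) (𝓝 0) := by
        have := (Real.continuousAt_rpow_const 0 (κ / (c + 1)) (Or.inr (by positivity))).tendsto
        rw [Real.zero_rpow (by positivity)] at this
        exact this.mono_left nhdsWithin_le_nhds
      have h8 := h6.mul h7
      rw [mul_zero] at h8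
      refine h8.congr' ?_
      filter_upwards [self_mem_nhdsWithin] with x hx
      have hx : 0 < x := hx
      rw [abs_mul, mul_pow, abs_of_nonneg (Real.rpow_nonneg hx.le _), ← Real.rpow_mul_natCast hx.le,
        mul_assoc, ← Real.rpow_add hx, mul_comm]
      congr 2
      field_simp
    refine h4.comp (tendsto_nhdsWithin_of_tendsto_nhds_of_eventually_within _ ?_ ?_)
    · have : Continuous fun x : ℝ => 1 - x := by fun_prop
      simpa using (this.tendsto 1).mono_left nhdsWithin_le_nhds
    · filter_upwards [self_mem_nhdsWithin] with x hx
      exact sub_pos.2 (Set.mem_Iio.1 hx)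
  have h9 : Tendsto (fun _ : ℝ => a) (𝓝[<] 1) (𝓝 0) := by
    rw [IsBigO] at h2
    obtain ⟨C, h2⟩ := h2
    have h10 := h3.const_mul C
    rw [mul_zero] at h10
    refine squeeze_zero_norm' ?_ h10
    have h2 := h2.bound
    rw [eventually_map] at h2
    filter_upwards [h2, self_mem_nhdsWithin] with x hx hx1
    have hx1 : x < 1 := hx1
    have e : ‖(1 : ℂ) - x‖ = 1 - x := by
      rw [← Complex.ofReal_one, ← Complex.ofReal_sub, Complex.norm_real,
        Real.norm_of_nonneg (by linarith)]
    simp only [Function.comp, id, e] at hx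
    rwa [Real.norm_of_nonneg] at hx
    have : 0 ≤ 1 - x := by linarith
    positivity
  exact tendsto_nhds_unique tendsto_const_nhds h9

/-! ### Slices of decomposed paths -/

theorem height_zero (l : List DyckStep) : height l 0 = 0 := by simp [height]

theorem height_of_length_le (l : List DyckStep) {k : ℕ} (hk : l.length ≤ k) :
    height l k = (l.count DyckStep.U : ℤ) - l.count DyckStep.D := by
  rw [height, List.take_of_length_le hk]

theorem height_append_of_le {l₁ : List DyckStep} (l₂ : List DyckStep) {k : ℕ}
    (hk : k ≤ l₁.length) : height (l₁ ++ l₂) k = height l₁ k := by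
  simp only [height, List.take_append_of_le_length hk]

theorem height_append_add (l₁ l₂ : List DyckStep) (k : ℕ) :
    height (l₁ ++ l₂) (l₁.length + k) = height l₁ l₁.length + height l₂ k := by
  simp only [height, List.take_length_add_append, List.take_length, List.count_append]
  push_cast
  ring

theorem height_cons_succ (a : DyckStep) (l : List DyckStep) (k : ℕ) :
    height (a :: l) (k + 1) = height [a] 1 + height l k := by
  have := height_append_add [a] l k
  simpa [add_comm 1 k] using this

theorem height_singleton_U : height [DyckStep.U] 1 = 1 := by simp [height]

theorem height_singleton_D : height [DyckStep.D] 1 = -1 := by simp [height]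

theorem mem_slices {l : List DyckStep} {e : ℕ × ℕ} : e ∈ slices l ↔ IsSlice l e.1 e.2 := by
  classical
  simp only [slices, Finset.mem_filter, Finset.mem_product, Finset.mem_range]
  refine ⟨fun h => h.2, fun h => ⟨⟨h.1.trans h.2.1, h.2.1⟩, h⟩⟩

/-- A slice cannot extend over a point where the path meets the axis. -/
theorem isSlice_append_iff {l₁ l₂ : List DyckStep} (h₁ : height l₁ l₁.length = 0) {i j : ℕ} :
    IsSlice (l₁ ++ l₂) i j ↔ IsSlice l₁ i j ∨
      ∃ i' j', IsSlice l₂ i' j' ∧ l₁.length + i' = i ∧ l₁.length + j' = j := by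
  have hL : ∀ k, k ≤ l₁.length → height (l₁ ++ l₂) k = height l₁ k :=
    fun k hk => height_append_of_le l₂ hk
  have hR : ∀ k, height (l₁ ++ l₂) (l₁.length + k) = height l₂ k := fun k => by
    rw [height_append_add, h₁, zero_add]
  constructor
  · rintro ⟨hij, hj, hh, hor⟩
    rw [List.length_append] at hj
    rcases lt_or_ge j l₁.length with hj1 | hj1
    · left
      rw [hL _ (by omega), hL _ (by omega)] at hh
      refine ⟨hij, hj1, hh, ?_⟩
      rw [hL i (by omega)] at hor
      refine hor.imp (fun h => ⟨h.1, fun k h1 h2 => ?_⟩) (fun h => ⟨h.1, fun k h1 h2 => ?_⟩)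
      · rw [← hL k (by omega)]
        exact h.2 k h1 h2
      · rw [← hL k (by omega)]
        exact h.2 k h1 h2
    · rcases lt_or_ge i l₁.length with hi | hi
      · exfalso
        have h0 := hL l₁.length le_rfl
        rw [h₁] at h0
        rcases hor with h | h
        · have := h.2 l₁.length hi hj1
          omega
        · have := h.2 l₁.length hi hj1
          omega
      · right
        obtain ⟨i, rfl⟩ := Nat.exists_eq_add_of_le hi
        obtain ⟨j, rfl⟩ := Nat.exists_eq_add_of_le hj1
        refine ⟨i, j, ⟨by omega, by omega, ?_, ?_⟩, rfl, rfl⟩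
        · rwa [add_assoc, hR, hR] at hh
        · rw [hR] at hor
          refine hor.imp (fun h => ⟨h.1, fun k h1 h2 => ?_⟩) (fun h => ⟨h.1, fun k h1 h2 => ?_⟩)
          · rw [← hR k]
            exact h.2 _ (by omega) (by omega)
          · rw [← hR k]
            exact h.2 _ (by omega) (by omega)
  · rintro (⟨hij, hj, hh, hor⟩ | ⟨i, j, ⟨hij, hj, hh, hor⟩, rfl, rfl⟩)
    · refine ⟨hij, by rw [List.length_append]; omega, ?_, ?_⟩
      · rwa [hL _ (by omega), hL _ (by omega)]
      · rw [hL i (by omega)]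
        refine hor.imp (fun h => ⟨h.1, fun k h1 h2 => ?_⟩) (fun h => ⟨h.1, fun k h1 h2 => ?_⟩)
        · rw [hL k (by omega)]
          exact h.2 k h1 h2
        · rw [hL k (by omega)]
          exact h.2 k h1 h2
    · refine ⟨by omega, by rw [List.length_append]; omega, ?_, ?_⟩
      · rwa [add_assoc, hR, hR]
      · rw [hR]
        refine hor.imp (fun h => ⟨h.1, fun k h1 h2 => ?_⟩) (fun h => ⟨h.1, fun k h1 h2 => ?_⟩)
        · obtain ⟨k, rfl⟩ := Nat.exists_eq_add_of_le (show l₁.length ≤ k by omega)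
          rw [hR k]
          exact h.2 _ (by omega) (by omega)
        · obtain ⟨k, rfl⟩ := Nat.exists_eq_add_of_le (show l₁.length ≤ k by omega)
          rw [hR k]
          exact h.2 _ (by omega) (by omega)

/-- Translation of a pair of positions. -/
def shiftPair (n : ℕ) : ℕ × ℕ ↪ ℕ × ℕ :=
  ⟨fun e => (n + e.1, n + e.2), fun a b h => by
    simp only [Prod.mk.injEq, add_right_inj] at h
    exact Prod.ext h.1 h.2⟩

theorem shiftPair_apply (n : ℕ) (e : ℕ × ℕ) : shiftPair n e = (n + e.1, n + e.2) := rfl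

theorem sum_map_shiftPair (ω : ℕ → ℝ) (ε : ℝ) (n : ℕ) (l : List DyckStep) :
    ∑ e ∈ (slices l).map (shiftPair n), (ω ((e.2 - e.1 - 1) / 2) - ε) = area ω ε l := by
  rw [Finset.sum_map]
  refine Finset.sum_congr rfl fun e _ => ?_
  simp only [shiftPair_apply, Nat.add_sub_add_left]

theorem area_append (ω : ℕ → ℝ) (ε : ℝ) {l₁ : List DyckStep} (l₂ : List DyckStep)
    (h₁ : height l₁ l₁.length = 0) : area ω ε (l₁ ++ l₂) = area ω ε l₁ + area ω ε l₂ := by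
  have hd : Disjoint (slices l₁) ((slices l₂).map (shiftPair l₁.length)) := by
    rw [Finset.disjoint_left]
    rintro e he he'
    obtain ⟨e', -, rfl⟩ := Finset.mem_map.1 he'
    have := (mem_slices.1 he).2.1
    simp [shiftPair_apply] at this
  have hu : slices (l₁ ++ l₂) = (slices l₁).disjUnion _ hd := by
    ext ⟨i, j⟩
    rw [Finset.mem_disjUnion, mem_slices, mem_slices, isSlice_append_iff h₁, Finset.mem_map]
    simp only [shiftPair_apply, Prod.mk.injEq, Prod.exists, mem_slices]
  rw [area, hu, Finset.sum_disjUnion, sum_map_shiftPair, area, area]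

theorem height_dyckWord_nonneg (w : DyckWord) (k : ℕ) : 0 ≤ height w.toList k := by
  have := w.count_D_le_count_U k
  simp only [height]
  omega

theorem height_dyckWord_length (w : DyckWord) : height w.toList w.toList.length = 0 := by
  rw [height_of_length_le _ le_rfl, w.count_U_eq_count_D, sub_self]

/-- Lifting an excursion adds the bottom slice, which spans the whole path. -/
theorem isSlice_nest_iff (w : DyckWord) {i j : ℕ} :
    IsSlice w.nest.toList i j ↔ (i = 0 ∧ j = w.toList.length + 1) ∨
      ∃ i' j', IsSlice w.toList i' j' ∧ 1 + i' = i ∧ 1 + j' = j := by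
  have hl : w.nest.toList = DyckStep.U :: (w.toList ++ [DyckStep.D]) := rfl
  have hlen : w.nest.toList.length = w.toList.length + 2 := by simp [hl]
  have h0 : height w.nest.toList 0 = 0 := height_zero _
  have hS : ∀ k, k ≤ w.toList.length →
      height w.nest.toList (k + 1) = 1 + height w.toList k := fun k hk => by
    rw [hl, height_cons_succ, height_singleton_U, height_append_of_le _ hk]
  have hE : height w.nest.toList (w.toList.length + 2) = 0 := by
    rw [← hlen]
    exact height_dyckWord_length _
  have hpos := height_dyckWord_nonneg w
  generalize w.nest.toList = L at *
  constructor
  · rintro ⟨hij, hj, hh, hor⟩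
    rcases i with _ | i
    · left
      refine ⟨rfl, ?_⟩
      by_contra hne
      rw [hS j (by omega), h0] at hh
      linarith [hpos j]
    · right
      obtain ⟨j, rfl⟩ : ∃ j', j = j' + 1 := ⟨j - 1, by omega⟩
      have hi := hS i (by omega)
      have hjn : j ≠ w.toList.length := by
        rintro rfl
        rw [hE, hi] at hh
        linarith [hpos i]
      rw [hS (j + 1) (by omega), hi] at hh
      refine ⟨i, j, ⟨by omega, by omega, by omega, Or.inl ⟨hpos i, fun k h1 h2 => ?_⟩⟩,
        by omega, by omega⟩
      rcases hor with h | h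
      · have := h.2 (k + 1) (by omega) (by omega)
        rw [hS k (by omega)] at this
        omega
      · have := hpos i
        omega
  · rintro (⟨rfl, rfl⟩ | ⟨i, j, ⟨hij, hj, hh, hor⟩, rfl, rfl⟩)
    · refine ⟨by omega, by omega, by rw [hE, h0], Or.inl ⟨h0.ge, fun k h1 h2 => ?_⟩⟩
      obtain ⟨k, rfl⟩ : ∃ k', k = k' + 1 := ⟨k - 1, by omega⟩
      rw [hS k (by omega), h0]
      linarith [hpos k]
    · have hi := hS i (by omega)
      rw [add_comm 1 i, add_comm 1 j]
      refine ⟨by omega, by omega, ?_, Or.inl ⟨?_, fun k h1 h2 => ?_⟩⟩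
      · rw [hS (j + 1) (by omega), hi, hh]
      · linarith [hpos i]
      · obtain ⟨k, rfl⟩ : ∃ k', k = k' + 1 := ⟨k - 1, by omega⟩
        rw [hS k (by omega), hi]
        rcases hor with h | h
        · linarith [h.2 k (by omega) (by omega)]
        · linarith [h.2 k (by omega) (by omega), h.1, hpos k]

theorem area_nest (ω : ℕ → ℝ) (ε : ℝ) (w : DyckWord) :
    area ω ε w.nest.toList = area ω ε w.toList + (ω w.semilength - ε) := by
  have hd : Disjoint {(0, w.toList.length + 1)} ((slices w.toList).map (shiftPair 1)) := by
    rw [Finset.disjoint_left]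
    rintro e he he'
    obtain ⟨e', -, rfl⟩ := Finset.mem_map.1 he'
    simp [shiftPair_apply] at he
  have hu : slices w.nest.toList = Finset.disjUnion {(0, w.toList.length + 1)} _ hd := by
    ext ⟨i, j⟩
    rw [Finset.mem_disjUnion, mem_slices, isSlice_nest_iff, Finset.mem_map]
    simp only [shiftPair_apply, Prod.mk.injEq, Prod.exists, mem_slices,
      Finset.mem_singleton]
  rw [area, hu, Finset.sum_disjUnion, sum_map_shiftPair, Finset.sum_singleton, add_comm]
  congr 3
  have := w.two_mul_semilength_eq_length
  dsimp only
  omega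

/-- Reflection of a path in the horizontal axis, depending on a sign. -/
def orient (b : Bool) (l : List DyckStep) : List DyckStep :=
  if b then l.map fun | .U => .D | .D => .U else l

theorem orient_orient (b : Bool) (l : List DyckStep) : orient b (orient b l) = l := by
  cases b
  · rfl
  · simp only [orient, if_true, List.map_map]
    conv_rhs => rw [← List.map_id l]
    congr 1
    funext a
    cases a <;> rfl

theorem orient_append (b : Bool) (l₁ l₂ : List DyckStep) :
    orient b (l₁ ++ l₂) = orient b l₁ ++ orient b l₂ := by
  cases b <;> simp [orient]

theorem length_orient (b : Bool) (l : List DyckStep) : (orient b l).length = l.length := by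
  cases b <;> simp [orient]

theorem height_orient_true (l : List DyckStep) (k : ℕ) :
    height (orient true l) k = -height l k := by
  induction l generalizing k with
  | nil => simp [orient, height]
  | cons a l ih =>
    rcases k with _ | k
    · simp [height_zero]
    · have : orient true (a :: l) = orient true [a] ++ orient true l := orient_append true [a] l
      have e : orient true [a] ++ orient true l =
          (match a with | .U => DyckStep.D | .D => DyckStep.U) :: orient true l := by
        cases a <;> rfl
      rw [this, e, height_cons_succ _ _ k, height_cons_succ a l k, ih]
      cases a <;> simp only [height_singleton_U, height_singleton_D] <;> ring

theorem area_orient (ω : ℕ → ℝ) (ε : ℝ) (b : Bool) (l : List DyckStep) :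
    area ω ε (orient b l) = area ω ε l := by
  cases b
  · rfl
  · have : slices (orient true l) = slices l := by
      ext ⟨i, j⟩
      rw [mem_slices, mem_slices]
      simp only [IsSlice, length_orient, height_orient_true, neg_inj, neg_lt_neg_iff,
        Left.neg_nonpos_iff, Left.nonneg_neg_iff]
      rw [or_comm]
    rw [area, this, area]

theorem count_orient_true (l : List DyckStep) :
    (orient true l).count DyckStep.U = l.count DyckStep.D ∧
      (orient true l).count DyckStep.D = l.count DyckStep.U := by
  induction l with
  | nil => simp [orient]
  | cons a l ih =>
    have e : orient true (a :: l) =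
        (match a with | .U => DyckStep.D | .D => DyckStep.U) :: orient true l := by
      cases a <;> rfl
    rw [e]
    cases a <;> simp [ih.1, ih.2]

theorem orient_mem_bridges {N : ℕ} {b : Bool} {l : List DyckStep} (hl : l ∈ bridges N) :
    orient b l ∈ bridges N := by
  cases b
  · exact hl
  · rw [mem_bridges] at hl ⊢
    rw [(count_orient_true l).1, (count_orient_true l).2]
    exact hl.symm

/-! ### Decomposition at the first return to the axis -/

/-- The excursions of size `N`. -/
def excursions (N : ℕ) : Finset DyckWord :=
  (Finset.univ : Finset {w : DyckWord // w.semilength = N}).map (Function.Embedding.subtype _)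

theorem mem_excursions {N : ℕ} {w : DyckWord} : w ∈ excursions N ↔ w.semilength = N := by
  simp [excursions]

theorem sum_excursions_succ (N : ℕ) (g : DyckWord → ℝ) :
    ∑ w ∈ excursions (N + 1), g w =
      ∑ x ∈ antidiagonal N, ∑ y ∈ excursions x.1 ×ˢ excursions x.2, g (y.1.nest + y.2) := by
  rw [Finset.sum_sigma']
  refine Finset.sum_bij'
    (fun w _ => ⟨(w.insidePart.semilength, w.outsidePart.semilength),
      (w.insidePart, w.outsidePart)⟩) (fun y _ => y.2.1.nest + y.2.2) ?_ ?_ ?_ ?_ ?_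
  · intro w hw
    rw [mem_excursions] at hw
    have hw0 : w ≠ 0 := by
      rintro rfl
      simp at hw
    have := DyckWord.semilength_insidePart_add_semilength_outsidePart_add_one hw0
    simp only [Finset.mem_sigma, mem_antidiagonal, Finset.mem_product, mem_excursions, and_true]
    omega
  · rintro ⟨x, u, v⟩ h
    simp only [Finset.mem_sigma, mem_antidiagonal, Finset.mem_product, mem_excursions] at h
    rw [mem_excursions, DyckWord.semilength_add, DyckWord.semilength_nest]
    dsimp only
    omega
  · intro w hw
    rw [mem_excursions] at hw
    have hw0 : w ≠ 0 := by
      rintro rfl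
      simp at hw
    exact DyckWord.nest_insidePart_add_outsidePart hw0
  · rintro ⟨⟨i, j⟩, u, v⟩ h
    simp only [Finset.mem_sigma, mem_antidiagonal, Finset.mem_product, mem_excursions] at h
    obtain ⟨-, rfl, rfl⟩ := h
    simp
  · intro w hw
    rw [mem_excursions] at hw
    have hw0 : w ≠ 0 := by
      rintro rfl
      simp at hw
    simp only [DyckWord.nest_insidePart_add_outsidePart hw0]

/-- A lifted excursion stays above the axis, so its end is the first return. -/
theorem height_nest_pos (w : DyckWord) {k : ℕ} (hk0 : 0 < k) (hk : k < w.nest.toList.length) :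
    0 < height w.nest.toList k := by
  have := (DyckWord.IsNested.nest (p := w)).2 hk0 hk
  simp only [height]
  omega

/-- The first return to the axis determines the decomposition. -/
theorem nest_append_injective {w w' : DyckWord} {l l' : List DyckStep}
    (h : w.nest.toList ++ l = w'.nest.toList ++ l') : w = w' ∧ l = l' := by
  have key : ∀ {w w' : DyckWord} {l l' : List DyckStep},
      w.nest.toList ++ l = w'.nest.toList ++ l' →
        w'.nest.toList.length ≤ w.nest.toList.length := by
    intro w w' l l' h
    by_contra! hlt
    have h1 := height_append_of_le l (le_refl w.nest.toList.length)
    have h2 := height_append_of_le l' hlt.le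
    rw [h, h2, height_dyckWord_length] at h1
    have h3 : 0 < w.nest.toList.length := by simp [DyckWord.nest]
    exact (height_nest_pos w' h3 hlt).ne' h1
  obtain ⟨h1, h2⟩ := List.append_inj h (le_antisymm (key h.symm) (key h))
  refine ⟨?_, h2⟩
  have h3 : w.nest = w'.nest := DyckWord.ext h1
  rw [← DyckWord.insidePart_nest (p := w), h3, DyckWord.insidePart_nest]

theorem height_succ_ge (l : List DyckStep) (k : ℕ) : height l k - 1 ≤ height l (k + 1) := by
  induction l generalizing k with
  | nil => simp [height]
  | cons a l ih =>
    rcases k with _ | k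
    · rw [height_cons_succ, height_zero, height_zero]
      cases a <;> simp [height]
    · rw [height_cons_succ a l k, height_cons_succ a l (k + 1)]
      have := ih k
      omega

/-- A bridge that starts with an up-step is a lifted excursion up to its first return. -/
theorem exists_nest_append {N : ℕ} {l : List DyckStep} (hl : DyckStep.U :: l ∈ bridges (N + 1)) :
    ∃ (w : DyckWord) (l' : List DyckStep), w.nest.toList ++ l' = DyckStep.U :: l := by
  rw [mem_bridges] at hl
  set L := DyckStep.U :: l with hL
  have hret : ∃ k, 0 < k ∧ height L k = 0 :=
    ⟨L.length, by simp [hL], by rw [height_of_length_le _ le_rfl, hl.1, hl.2, sub_self]⟩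
  classical
  obtain ⟨h0, hk⟩ := Nat.find_spec hret
  have hmin : ∀ k, 0 < k → k < Nat.find hret → height L k ≠ 0 :=
    fun k hk1 hk2 hk3 => Nat.find_min hret hk2 ⟨hk1, hk3⟩
  set n := Nat.find hret
  have hpos : ∀ k, 0 < k → k < n → 0 < height L k := by
    intro k hk1
    induction k, hk1 using Nat.le_induction with
    | base =>
      intro _
      rw [hL, height_cons_succ, height_singleton_U, height_zero]
      norm_num
    | succ k hk1 ih =>
      intro hk2
      have h1 := ih (by omega)
      have h2 := height_succ_ge L k
      have h3 := hmin (k + 1) (by omega) hk2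
      omega
  have hnn : ∀ k, k ≤ n → 0 ≤ height L k := by
    intro k hkn
    rcases Nat.eq_zero_or_pos k with rfl | hk0
    · rw [height_zero]
    · rcases hkn.lt_or_eq with h | rfl
      · exact (hpos k hk0 h).le
      · exact hk.ge
  have htake : ∀ k, height (L.take n) k = height L (min k n) := fun k => by
    simp only [height, List.take_take]
  let w : DyckWord := ⟨L.take n, by
    have := hk
    simp only [height] at this
    omega, fun k => by
    have h1 := htake k
    have h2 := hnn (min k n) (min_le_right _ _)
    simp only [height] at h1 h2
    omega⟩
  have hw : w.IsNested := by
    refine ⟨?_, fun i hi1 hi2 => ?_⟩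
    · rw [← DyckWord.toList_ne_nil]
      intro h
      have : (L.take n).length = 0 := by
        change w.toList.length = 0
        rw [h]
        rfl
      rw [List.length_take] at this
      simp [hL] at this
      omega
    · have hi3 : i < n := hi2.trans_le (List.length_take_le _ _)
      have h1 := htake i
      have h2 := hpos (min i n) (by omega) (by omega)
      simp only [height] at h1 h2
      change ((L.take n).take i).count DyckStep.D < ((L.take n).take i).count DyckStep.U
      omega
  refine ⟨w.denest hw, L.drop n, ?_⟩
  rw [DyckWord.nest_denest]
  exact List.take_append_drop n L

theorem count_nest (w : DyckWord) :
    w.nest.toList.count DyckStep.U = w.semilength + 1 ∧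
      w.nest.toList.count DyckStep.D = w.semilength + 1 := by
  have h1 := w.semilength_nest
  have h2 := h1
  rw [DyckWord.semilength_eq_count_D] at h2
  exact ⟨h1, h2⟩

theorem nest_append_mem_bridges {w : DyckWord} {l : List DyckStep} {N : ℕ} :
    w.nest.toList ++ l ∈ bridges (N + 1) ↔ ∃ j, w.semilength + j = N ∧ l ∈ bridges j := by
  simp only [mem_bridges, List.count_append, (count_nest w).1, (count_nest w).2]
  constructor
  · rintro ⟨h1, h2⟩
    exact ⟨_, by omega, rfl, by omega⟩
  · rintro ⟨j, rfl, h1, h2⟩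
    omega

/-- A nonempty bridge is a lifted excursion or the reflection of one, followed by a bridge. -/
theorem sum_bridges_succ (N : ℕ) (g : List DyckStep → ℝ) :
    ∑ l ∈ bridges (N + 1), g l =
      ∑ x ∈ antidiagonal N, ∑ y ∈ excursions x.1 ×ˢ bridges x.2 ×ˢ (Finset.univ : Finset Bool),
        g (orient y.2.2 y.1.nest.toList ++ y.2.1) := by
  rw [Finset.sum_sigma']
  symm
  have hcons : ∀ (b : Bool) (w : DyckWord), ∃ t, orient b w.nest.toList =
      (if b then DyckStep.D else DyckStep.U) :: t := by
    intro b w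
    cases b
    · exact ⟨_, rfl⟩
    · exact ⟨_, rfl⟩
  refine Finset.sum_nbij (fun y => orient y.2.2.2 y.2.1.nest.toList ++ y.2.2.1) ?_ ?_ ?_ ?_
  · rintro ⟨⟨i, j⟩, w, l, b⟩ h
    simp only [Finset.mem_sigma, mem_antidiagonal, Finset.mem_product, mem_excursions,
      Finset.mem_univ, and_true] at h
    obtain ⟨rfl, rfl, hl⟩ := h
    have : w.nest.toList ++ orient b l ∈ bridges (w.semilength + j + 1) :=
      nest_append_mem_bridges.2 ⟨j, rfl, orient_mem_bridges hl⟩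
    have := orient_mem_bridges (b := b) this
    rwa [orient_append, orient_orient] at this
  -- The first step of the path determines the sign.
  · rintro ⟨⟨i, j⟩, w, l, b⟩ h ⟨⟨i', j'⟩, w', l', b'⟩ h' heq
    simp only [Finset.coe_sigma, Set.mem_sigma_iff, Finset.mem_coe, mem_antidiagonal,
      Finset.mem_product, mem_excursions, Finset.mem_univ, and_true] at h h'
    dsimp only at heq
    have hb : b = b' := by
      obtain ⟨t, ht⟩ := hcons b w
      obtain ⟨t', ht'⟩ := hcons b' w'
      rw [ht, ht'] at heq
      have := (List.cons_eq_cons.1 heq).1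
      cases b <;> cases b' <;> simp_all
    subst hb
    have h2 := congrArg (orient b) heq
    rw [orient_append, orient_append, orient_orient, orient_orient] at h2
    obtain ⟨rfl, h3⟩ := nest_append_injective h2
    have h4 := congrArg (orient b) h3
    rw [orient_orient, orient_orient] at h4
    subst h4
    obtain ⟨h5, rfl, -⟩ := h
    obtain ⟨h6, rfl, -⟩ := h'
    obtain rfl : j = j' := by omega
    rfl
  -- A reflection makes the first step an up-step.
  · intro l hl
    obtain ⟨b, hb⟩ : ∃ b, ∃ t, orient b l = DyckStep.U :: t := by
      have hl := hl
      rw [Finset.mem_coe, mem_bridges] at hl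
      rcases l with _ | ⟨a, t⟩
      · simp at hl
      · cases a
        · exact ⟨false, _, rfl⟩
        · exact ⟨true, _, rfl⟩
    obtain ⟨t, ht⟩ := hb
    have hmem := orient_mem_bridges (b := b) (Finset.mem_coe.1 hl)
    obtain ⟨w, l', hw⟩ := exists_nest_append (ht ▸ hmem)
    rw [ht, ← hw] at hmem
    obtain ⟨j, hj, hl'⟩ := nest_append_mem_bridges.1 hmem
    refine ⟨⟨(w.semilength, j), w, orient b l', b⟩, ?_, ?_⟩
    · simp only [Finset.coe_sigma, Set.mem_sigma_iff, Finset.mem_coe, mem_antidiagonal,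
        Finset.mem_product, mem_excursions, Finset.mem_univ, and_true]
      exact ⟨hj, trivial, orient_mem_bridges hl'⟩
    · dsimp only
      rw [← orient_append, hw, ← ht, orient_orient]
  · rintro ⟨x, w, l, b⟩ _
    rfl

section

/-! ### Functional equations for the generating functions -/

/-- The term of degree `s` of the exponential series. -/
def expTerm (s : ℕ) (x : ℝ) : ℝ := x ^ s / s.factorial

theorem expTerm_zero (x : ℝ) : expTerm 0 x = 1 := by simp [expTerm]

theorem expTerm_one (x : ℝ) : expTerm 1 x = x := by simp [expTerm]

theorem expTerm_at_zero (s : ℕ) : expTerm s 0 = if s = 0 then 1 else 0 := by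
  rcases s with _ | s <;> simp [expTerm]

theorem expTerm_add (s : ℕ) (x y : ℝ) :
    expTerm s (x + y) = ∑ a ∈ antidiagonal s, expTerm a.1 x * expTerm a.2 y := by
  rw [expTerm, (Commute.all x y).add_pow', Finset.sum_div]
  refine Finset.sum_congr rfl fun a ha => ?_
  rw [mem_antidiagonal] at ha
  subst ha
  have h := Nat.add_choose_mul_factorial_mul_factorial a.1 a.2
  have h1 : ((a.1 + a.2).choose a.1 : ℝ) * a.1.factorial * a.2.factorial =
    (a.1 + a.2).factorial := by
    rw [Nat.choose_symm_add]
    exact_mod_cast h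
  have h2 : (a.1.factorial : ℝ) ≠ 0 := by exact_mod_cast a.1.factorial_ne_zero
  have h3 : (a.2.factorial : ℝ) ≠ 0 := by exact_mod_cast a.2.factorial_ne_zero
  rw [nsmul_eq_mul, expTerm, expTerm, ← h1]
  have h4 : ((a.1 + a.2).choose a.1 : ℝ) ≠ 0 := by
    exact_mod_cast (Nat.choose_pos (Nat.le_add_right _ _)).ne'
  field_simp

/-- The generating function `E_s` as a formal power series. -/
def seriesE (ω : ℕ → ℝ) (ε : ℝ) (s : ℕ) : PowerSeries ℝ := PowerSeries.mk (coeffE ω ε s)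

/-- The generating function `B_s` as a formal power series. -/
def seriesB (ω : ℕ → ℝ) (ε : ℝ) (s : ℕ) : PowerSeries ℝ := PowerSeries.mk (coeffB ω ε s)

/-- The analogue of `E_s` for lifted excursions: the lift adds `ω N - ε` to the area. -/
def seriesLift (ω : ℕ → ℝ) (ε : ℝ) (s : ℕ) : PowerSeries ℝ :=
  PowerSeries.mk fun N => ∑ a ∈ antidiagonal s, expTerm a.1 (ω N - ε) * coeffE ω ε a.2 N

variable (ω : ℕ → ℝ) (ε : ℝ)

theorem coeffE_eq (s N : ℕ) : coeffE ω ε s N =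
    1 / 2 * (1 / 4) ^ N * ∑ w ∈ excursions N, expTerm s (area ω ε w.toList) := by
  rw [coeffE, excursionSum, excursions, Finset.sum_map]
  simp only [expTerm, Finset.sum_div, Function.Embedding.coe_subtype]
  ring

theorem coeffB_eq (s N : ℕ) : coeffB ω ε s N =
    (1 / 4) ^ N * ∑ l ∈ bridges N, expTerm s (area ω ε l) := by
  rw [coeffB, bridgeSum]
  simp only [expTerm, Finset.sum_div]
  ring

theorem coeff_seriesLift_eq (s N : ℕ) : PowerSeries.coeff N (seriesLift ω ε s) =
    1 / 2 * (1 / 4) ^ N * ∑ w ∈ excursions N, expTerm s (area ω ε w.nest.toList) := by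
  have h : ∀ w ∈ excursions N, expTerm s (area ω ε w.nest.toList) =
      ∑ a ∈ antidiagonal s, expTerm a.1 (ω N - ε) * expTerm a.2 (area ω ε w.toList) := by
    intro w hw
    rw [mem_excursions] at hw
    rw [area_nest, hw, add_comm, expTerm_add]
  rw [Finset.sum_congr rfl h, Finset.sum_comm, seriesLift, PowerSeries.coeff_mk, Finset.mul_sum]
  refine Finset.sum_congr rfl fun a _ => ?_
  rw [coeffE_eq, ← Finset.mul_sum]
  ring

theorem area_nil : area ω ε [] = 0 := by simp [area, slices]

theorem excursions_zero : excursions 0 = {0} := by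
  ext w
  rw [mem_excursions, Finset.mem_singleton]
  refine ⟨fun h => ?_, fun h => by rw [h]; rfl⟩
  have := w.two_mul_semilength_eq_length
  rw [h, mul_zero, eq_comm, List.length_eq_zero_iff] at this
  exact DyckWord.toList_eq_nil.1 this

theorem bridges_zero : bridges 0 = {[]} := by simp [bridges]

theorem coeff_succ_ite (s N : ℕ) :
    PowerSeries.coeff (N + 1) (if s = 0 then (1 : PowerSeries ℝ) else 0) = 0 := by
  split_ifs <;> simp [PowerSeries.coeff_one]

/-- Decomposition of nonempty excursions as `w.nest + v`. -/
theorem two_mul_seriesE (s : ℕ) : 2 * seriesE ω ε s = (if s = 0 then 1 else 0) +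
    PowerSeries.X * ∑ a ∈ antidiagonal s, seriesLift ω ε a.1 * seriesE ω ε a.2 := by
  ext N
  have h2 : ∀ f : PowerSeries ℝ, PowerSeries.coeff N (2 * f) = 2 * PowerSeries.coeff N f :=
    fun f => by rw [← map_ofNat (PowerSeries.C (R := ℝ)) 2, PowerSeries.coeff_C_mul]
  rw [h2, map_add, seriesE, PowerSeries.coeff_mk, coeffE_eq]
  rcases N with _ | N
  · rw [excursions_zero, Finset.sum_singleton, PowerSeries.coeff_zero_X_mul]
    change 2 * (1 / 2 * (1 / 4) ^ 0 * expTerm s (area ω ε [])) = _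
    rw [area_nil, expTerm_at_zero]
    split_ifs <;> simp
  · rw [coeff_succ_ite, zero_add, PowerSeries.coeff_succ_X_mul, map_sum, sum_excursions_succ]
    simp only [PowerSeries.coeff_mul]
    rw [Finset.sum_comm, Finset.mul_sum, Finset.mul_sum]
    refine Finset.sum_congr rfl fun x hx => ?_
    rw [mem_antidiagonal] at hx
    subst hx
    have h : ∀ y ∈ excursions x.1 ×ˢ excursions x.2,
        expTerm s (area ω ε (y.1.nest + y.2).toList) = ∑ a ∈ antidiagonal s,
          expTerm a.1 (area ω ε y.1.nest.toList) * expTerm a.2 (area ω ε y.2.toList) := by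
      rintro ⟨u, v⟩ _
      rw [← expTerm_add, ← area_append _ _ _ (height_dyckWord_length _)]
      rfl
    rw [Finset.sum_congr rfl h, Finset.sum_comm, Finset.mul_sum, Finset.mul_sum]
    refine Finset.sum_congr rfl fun a _ => ?_
    rw [coeff_seriesLift_eq, seriesE, PowerSeries.coeff_mk, coeffE_eq, Finset.sum_product]
    simp only [← Finset.sum_mul_sum]
    rw [pow_succ, pow_add]
    ring

/-- Decomposition of nonempty bridges; the two orientations of the first excursion cancel the factor
`1/2` in the normalization of `E_s`. -/
theorem seriesB_eq (s : ℕ) : seriesB ω ε s = (if s = 0 then 1 else 0) +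
    PowerSeries.X * ∑ a ∈ antidiagonal s, seriesLift ω ε a.1 * seriesB ω ε a.2 := by
  ext N
  rw [map_add, seriesB, PowerSeries.coeff_mk, coeffB_eq]
  rcases N with _ | N
  · rw [bridges_zero, Finset.sum_singleton, PowerSeries.coeff_zero_X_mul,
      area_nil, expTerm_at_zero]
    split_ifs <;> simp
  · rw [coeff_succ_ite, zero_add, PowerSeries.coeff_succ_X_mul, map_sum, sum_bridges_succ]
    simp only [PowerSeries.coeff_mul]
    rw [Finset.sum_comm, Finset.mul_sum]
    refine Finset.sum_congr rfl fun x hx => ?_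
    rw [mem_antidiagonal] at hx
    subst hx
    have h : ∀ y ∈ excursions x.1 ×ˢ bridges x.2 ×ˢ (Finset.univ : Finset Bool),
        expTerm s (area ω ε (orient y.2.2 y.1.nest.toList ++ y.2.1)) = ∑ a ∈ antidiagonal s,
          expTerm a.1 (area ω ε y.1.nest.toList) * expTerm a.2 (area ω ε y.2.1) := by
      rintro ⟨u, l, b⟩ _
      have h0 : height (orient b u.nest.toList) (orient b u.nest.toList).length = 0 := by
        rw [length_orient]
        cases b
        · exact height_dyckWord_length _
        · rw [height_orient_true, height_dyckWord_length, neg_zero]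
      rw [← expTerm_add, area_append _ _ _ h0, area_orient]
    rw [Finset.sum_congr rfl h, Finset.sum_comm, Finset.mul_sum]
    refine Finset.sum_congr rfl fun a _ => ?_
    rw [coeff_seriesLift_eq, seriesB, PowerSeries.coeff_mk, coeffB_eq, Finset.sum_product]
    simp only [Finset.sum_product, Finset.sum_const, Finset.card_univ, Fintype.card_bool,
      ← Finset.mul_sum, ← Finset.sum_mul, nsmul_eq_mul]
    rw [pow_succ, pow_add]
    push_cast
    ring

theorem seriesLift_zero : seriesLift ω ε 0 = seriesE ω ε 0 := by
  ext N
  simp [seriesLift, seriesE, expTerm_zero]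

theorem invPow_half_mul : invPow (1 / 2) * invPow (-1 / 2) = 1 := by
  rw [← invPow_add, ← invPow_zero]
  norm_num

/-- The quadratic equation for the Catalan generating function selects the square root of
`1 - X` with constant coefficient `1`. -/
theorem X_mul_seriesE_zero : PowerSeries.X * seriesE ω ε 0 = 1 - invPow (-1 / 2) := by
  have h := two_mul_seriesE ω ε 0
  simp only [if_true, Finset.Nat.antidiagonal_zero, Finset.sum_singleton, seriesLift_zero] at h
  have h1 : (1 - PowerSeries.X * seriesE ω ε 0) ^ 2 = invPow (-1 / 2) ^ 2 := by
    have h2 : invPow (-1 / 2) ^ 2 = 1 - PowerSeries.X := by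
      rw [sq, ← invPow_add, ← invPow_neg_one]
      norm_num
    rw [h2]
    linear_combination (-PowerSeries.X) * h
  rcases sq_eq_sq_iff_eq_or_eq_neg.1 h1 with h2 | h2
  · rw [← h2]
    ring
  · exfalso
    have h3 := congrArg (PowerSeries.coeff 0) h2
    rw [map_sub, map_neg, PowerSeries.coeff_zero_X_mul, coeff_zero_invPow] at h3
    norm_num at h3

theorem seriesB_zero : seriesB ω ε 0 = invPow (1 / 2) := by
  have h := seriesB_eq ω ε 0
  simp only [if_true, Finset.Nat.antidiagonal_zero, Finset.sum_singleton, seriesLift_zero] at h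
  have h1 := X_mul_seriesE_zero ω ε
  have h2 : seriesB ω ε 0 * invPow (-1 / 2) = 1 := by
    linear_combination h + seriesB ω ε 0 * h1
  linear_combination (-seriesB ω ε 0) * invPow_half_mul + invPow (1 / 2) * h2

/-- The linear equation for `E_{n+1}`, solved by means of `1 - X E_0 = (1 - X) ^ (1/2)`. -/
theorem two_mul_seriesE_succ (n : ℕ) : 2 * seriesE ω ε (n + 1) =
    invPow (1 / 2) * (PowerSeries.X *
      ∑ i ∈ Finset.range n, seriesLift ω ε (i + 1) * seriesE ω ε (n - i)) +
    invPow (1 / 2) * (seriesLift ω ε (n + 1) - seriesE ω ε (n + 1)) -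
    (seriesLift ω ε (n + 1) - seriesE ω ε (n + 1)) := by
  have h := two_mul_seriesE ω ε (n + 1)
  rw [if_neg (Nat.succ_ne_zero n), zero_add,
    Finset.Nat.sum_antidiagonal_eq_sum_range_succ
      (fun i j => seriesLift ω ε i * seriesE ω ε j), Finset.sum_range_succ,
    Finset.sum_range_succ', seriesLift_zero, Nat.sub_self, Nat.sub_zero] at h
  simp only [Nat.add_sub_add_right] at h
  have h1 := X_mul_seriesE_zero ω ε
  have h2 := invPow_half_mul
  set P := ∑ i ∈ Finset.range n, seriesLift ω ε (i + 1) * seriesE ω ε (n - i)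
  set E := seriesE ω ε (n + 1)
  set F := seriesLift ω ε (n + 1)
  have h3 : 2 * E * invPow (-1 / 2) = PowerSeries.X * P + (F - E) - invPow (-1 / 2) * (F - E) := by
    linear_combination h + (F + E) * h1
  linear_combination invPow (1 / 2) * h3 - (2 * E + (F - E)) * h2

theorem seriesB_succ (n : ℕ) : seriesB ω ε (n + 1) = invPow (1 / 2) * (PowerSeries.X *
    ∑ i ∈ Finset.range (n + 1), seriesLift ω ε (i + 1) * seriesB ω ε (n - i)) := by
  have h := seriesB_eq ω ε (n + 1)
  rw [if_neg (Nat.succ_ne_zero n), zero_add,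
    Finset.Nat.sum_antidiagonal_eq_sum_range_succ
      (fun i j => seriesLift ω ε i * seriesB ω ε j),
    Finset.sum_range_succ', seriesLift_zero, Nat.sub_zero] at h
  simp only [Nat.add_sub_add_right] at h
  have h1 := X_mul_seriesE_zero ω ε
  have h2 := invPow_half_mul
  set P := ∑ i ∈ Finset.range (n + 1), seriesLift ω ε (i + 1) * seriesB ω ε (n - i)
  set B := seriesB ω ε (n + 1)
  linear_combination invPow (1 / 2) * h + invPow (1 / 2) * B * h1 - B * h2

end

/-! ### Power series with one singular term -/

/-- The coefficients of `f` are those of `c (1 - X) ^ (-β)` up to `Õ(N ^ (β-1-δ))`. -/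
def HasSingularTerm (f : PowerSeries ℝ) (β δ c : ℝ) : Prop :=
  TildeONat (fun N => PowerSeries.coeff N f - c * PowerSeries.coeff N (invPow β)) (β - 1 - δ)

namespace HasSingularTerm

variable {f g : PowerSeries ℝ} {β γ δ c d : ℝ}

theorem mono (h : HasSingularTerm f β δ c) {δ' : ℝ} (hδ : δ' ≤ δ) : HasSingularTerm f β δ' c :=
  TildeONat.mono h (by linarith)

theorem of_tildeONat (h : TildeONat (fun N => PowerSeries.coeff N f) (β - 1 - δ)) :
    HasSingularTerm f β δ 0 := by
  simpa [HasSingularTerm] using h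

theorem invPow (β δ : ℝ) : HasSingularTerm (invPow β) β δ 1 := by
  simpa [HasSingularTerm] using tildeONat_zero _

theorem tildeONat (h : HasSingularTerm f β δ c) (hδ : 0 ≤ δ) :
    TildeONat (fun N => PowerSeries.coeff N f) (β - 1) := by
  have h1 := (TildeONat.mono h (show β - 1 - δ ≤ β - 1 by linarith)).add
    ((tildeONat_coeff_invPow β).const_mul c)
  simpa using h1

theorem add (hf : HasSingularTerm f β δ c) (hg : HasSingularTerm g β δ d) :
    HasSingularTerm (f + g) β δ (c + d) := by
  refine (TildeONat.add hf hg).congr' (Eventually.of_forall fun N => ?_)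
  simp only [map_add]
  ring

theorem sub (hf : HasSingularTerm f β δ c) (hg : HasSingularTerm g β δ d) :
    HasSingularTerm (f - g) β δ (c - d) := by
  refine (TildeONat.sub hf hg).congr' (Eventually.of_forall fun N => ?_)
  simp only [map_sub]
  ring

theorem of_two_mul (hf : HasSingularTerm (2 * f) β δ (2 * c)) : HasSingularTerm f β δ c := by
  refine (TildeONat.const_mul hf (1 / 2)).congr' (Eventually.of_forall fun N => ?_)
  simp only [← map_ofNat (PowerSeries.C (R := ℝ)) 2, PowerSeries.coeff_C_mul]
  ring

theorem sum {ι : Type*} {s : Finset ι} {f : ι → PowerSeries ℝ} {c : ι → ℝ}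
    (h : ∀ i ∈ s, HasSingularTerm (f i) β δ (c i)) :
    HasSingularTerm (∑ i ∈ s, f i) β δ (∑ i ∈ s, c i) := by
  refine (TildeONat.sum h).congr' (Eventually.of_forall fun N => ?_)
  simp only [map_sum, Finset.sum_sub_distrib, Finset.sum_mul]

theorem X_mul (hf : HasSingularTerm f β δ c) (hδ : δ ≤ 1) :
    HasSingularTerm (PowerSeries.X * f) β δ c := by
  have h1 : TildeONat (fun N => PowerSeries.coeff N (PowerSeries.X *
      (f - PowerSeries.C c * PAiry.invPow β))) (β - 1 - δ) :=
    TildeONat.coeff_X_mul (by simpa [HasSingularTerm] using hf)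
  have h2 := ((tildeONat_coeff_invPow (β - 1)).mono
    (show β - 1 - 1 ≤ β - 1 - δ by linarith)).const_mul c
  -- `(1 - X) (1 - X) ^ (-β)` has order `β - 1`.
  have h3 : PAiry.invPow (β - 1) = PAiry.invPow β - PowerSeries.X * PAiry.invPow β := by
    rw [sub_eq_add_neg, invPow_add, invPow_neg_one]
    ring
  refine (h1.sub h2).congr' (Eventually.of_forall fun N => ?_)
  have e : PowerSeries.X * (f - PowerSeries.C c * PAiry.invPow β) =
      PowerSeries.X * f - PowerSeries.C c * (PowerSeries.X * PAiry.invPow β) := by ring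
  simp only [h3, e, map_sub, PowerSeries.coeff_C_mul]
  ring

theorem mul (hf : HasSingularTerm f β δ c) (hg : HasSingularTerm g γ δ d) (hδ : 0 ≤ δ)
    (hβ : δ ≤ β) (hγ : δ ≤ γ) : HasSingularTerm (f * g) (β + γ) δ (c * d) := by
  -- `f g` is `u g + c (1 - X) ^ (-β) v` up to the product of the singular terms.
  set u := f - PowerSeries.C c * PAiry.invPow β with hu
  set v := g - PowerSeries.C d * PAiry.invPow γ with hv
  have hu' : TildeONat (fun N => PowerSeries.coeff N u) (β - δ - 1) := by
    rw [show β - δ - 1 = β - 1 - δ by ring]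
    simpa [HasSingularTerm, hu] using hf
  have hv' : TildeONat (fun N => PowerSeries.coeff N v) (γ - δ - 1) := by
    rw [show γ - δ - 1 = γ - 1 - δ by ring]
    simpa [HasSingularTerm, hv] using hg
  have h1 := (TildeONat.coeff_mul (sub_nonneg.2 hβ) (hδ.trans hγ) hu' (hg.tildeONat hδ)).mono
    (show β - δ + γ - 1 ≤ β + γ - 1 - δ by linarith)
  have h2 := ((TildeONat.coeff_mul (hδ.trans hβ) (sub_nonneg.2 hγ) (tildeONat_coeff_invPow β)
    hv').mono (show β + (γ - δ) - 1 ≤ β + γ - 1 - δ by linarith)).const_mul c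
  refine (h1.add h2).congr' (Eventually.of_forall fun N => ?_)
  have e : f * g = u * g + PowerSeries.C c * (PAiry.invPow β * v) +
      PowerSeries.C (c * d) * PAiry.invPow (β + γ) := by
    rw [invPow_add, hu, hv, map_mul]
    ring
  simp only [e, map_add, PowerSeries.coeff_C_mul]
  ring

/-- Multiplying the coefficients by `N ^ p (1 + Õ(N ^ (-δ)))` shifts the singular exponent. -/
theorem hadamard {w : ℕ → ℝ} {p : ℝ} (hf : HasSingularTerm f β δ c) (hδ : 0 ≤ δ) (hδ1 : δ ≤ 1)
    (hw : TildeONat (fun N => w N - (N : ℝ) ^ p) (p - δ)) (hΓ : Real.Gamma (β + p) ≠ 0) :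
    HasSingularTerm (PowerSeries.mk fun N => w N * PowerSeries.coeff N f) (β + p) δ
      (c * (Real.Gamma (β + p) / Real.Gamma β)) := by
  -- In turn, `w N`, the coefficients of `f`, those of `(1 - X) ^ (-β)` and the resulting power of
  -- `N` are replaced by their leading terms.
  have h1 := hw.mul (hf.tildeONat hδ)
  have h2 := (tildeONat_rpow p).mul hf
  have h3 := ((tildeONat_rpow p).mul ((tildeONat_coeff_invPow_sub (β := β)).mono
    (show β - 2 ≤ β - 1 - δ by linarith))).const_mul c
  have h4 := ((tildeONat_coeff_invPow_sub (β := β + p)).mono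
    (show β + p - 2 ≤ β + p - 1 - δ by linarith)).const_mul
      (c * (Real.Gamma (β + p) / Real.Gamma β))
  rw [show p - δ + (β - 1) = β + p - 1 - δ by ring] at h1
  rw [show p + (β - 1 - δ) = β + p - 1 - δ by ring] at h2 h3
  refine (((h1.add h2).add h3).sub h4).congr' ?_
  filter_upwards [eventually_ge_atTop 1] with N hN
  have hN0 : (0 : ℝ) < N := by exact_mod_cast hN
  rw [show β + p - 1 = p + (β - 1) by ring, Real.rpow_add hN0, PowerSeries.coeff_mk]
  have e : Real.Gamma (β + p) / Real.Gamma β * (Real.Gamma (β + p))⁻¹ = (Real.Gamma β)⁻¹ := by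
    field_simp
  linear_combination (c * (N : ℝ) ^ p * (N : ℝ) ^ (β - 1)) * e

theorem tildeONat_coeff_sub_rpow (hf : HasSingularTerm f β δ c) (hδ : δ ≤ 1) :
    TildeONat (fun N => PowerSeries.coeff N f - c / Real.Gamma β * (N : ℝ) ^ (β - 1))
      (β - 1 - δ) := by
  have h1 := ((tildeONat_coeff_invPow_sub (β := β)).mono
    (show β - 2 ≤ β - 1 - δ by linarith)).const_mul c
  refine (TildeONat.add hf h1).congr' (Eventually.of_forall fun N => ?_)
  ring

end HasSingularTerm

/-! ### Integration of the singularity -/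

theorem derivative_invPow (β : ℝ) :
    PowerSeries.derivative ℝ (invPow β) = PowerSeries.C β * invPow (β + 1) := by
  ext n
  rw [PowerSeries.coeff_derivative, PowerSeries.coeff_C_mul]
  have h1 := coeff_succ_invPow (β + 1) n
  have h2 : PowerSeries.coeff (n + 1) (invPow β) =
      PowerSeries.coeff (n + 1) (invPow (β + 1)) - PowerSeries.coeff n (invPow (β + 1)) := by
    have : invPow β = invPow (β + 1) - PowerSeries.X * invPow (β + 1) := by
      conv_lhs => rw [show β = β + 1 + -1 by ring, invPow_add, invPow_neg_one]
      ring
    rw [this, map_sub, PowerSeries.coeff_succ_X_mul]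
  rw [h2]
  linear_combination h1

theorem TildeONat.of_derivative {f : PowerSeries ℝ} {b : ℝ}
    (h : TildeONat (fun N => PowerSeries.coeff N (PowerSeries.derivative ℝ f)) (b + 1)) :
    TildeONat (fun N => PowerSeries.coeff N f) b := by
  refine .of_succ ?_
  have h1 : TildeONat (fun N : ℕ => ((N : ℝ) + 1)⁻¹) (-1) :=
    tildeONat_iff.2 ⟨1, 0, one_pos, fun N => by
      rw [abs_of_nonneg (by positivity), Real.rpow_neg_one]
      simp⟩
  have h2 := h1.mul h
  rw [show -1 + (b + 1) = b by ring] at h2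
  refine h2.congr' (Eventually.of_forall fun N => ?_)
  simp only [PowerSeries.coeff_derivative]
  field_simp

/-- Multiplication by `(1 - X) ^ (-1/2)` lowers the exponent of an error term by `1/2`. When the
coefficients are summable this needs their sum to vanish; the cancellation is exploited by
passing to the derivative. -/
theorem TildeONat.invPow_half_mul {f : PowerSeries ℝ} {κ : ℝ} (hκ : κ < 1)
    (hf : TildeONat (fun N => PowerSeries.coeff N f) (-κ - 1))
    (h0 : 0 < κ → ∑' N, PowerSeries.coeff N f = 0) :
    TildeONat (fun N => PowerSeries.coeff N (invPow (1 / 2) * f)) (-κ - 1 / 2) := by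
  rcases le_or_gt κ 0 with hκ0 | hκ0
  · have h := TildeONat.coeff_mul (show (0 : ℝ) ≤ 1 / 2 by norm_num) (show 0 ≤ -κ by linarith)
      (tildeONat_coeff_invPow (1 / 2)) hf
    rwa [show 1 / 2 + -κ - 1 = -κ - 1 / 2 by ring] at h
  · have hs : Summable fun N => PowerSeries.coeff N f := summable_abs_iff.1 (hf.summable_abs hκ0)
    set t : PowerSeries ℝ := PowerSeries.mk fun N => ∑' i, PowerSeries.coeff (i + N + 1) f with ht
    have htail : TildeONat (fun N => PowerSeries.coeff N t) (1 - κ - 1) := by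
      have := hf.tail hκ0
      simpa [ht] using this
    have hft : f = -((1 - PowerSeries.X) * t) := by
      ext N
      rw [map_neg, sub_mul, one_mul, map_sub]
      rcases N with _ | N
      · rw [PowerSeries.coeff_zero_X_mul, ht, PowerSeries.coeff_mk]
        have := hs.tsum_eq_zero_add
        rw [h0 hκ0] at this
        simp only [add_zero]
        linarith
      · rw [PowerSeries.coeff_succ_X_mul, ht, PowerSeries.coeff_mk, PowerSeries.coeff_mk]
        have h1 : Summable fun i => PowerSeries.coeff (i + N + 1) f :=
          (summable_nat_add_iff (f := fun i => PowerSeries.coeff i f) (N + 1)).2 hs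
        rw [h1.tsum_eq_zero_add, zero_add]
        have : ∀ i, i + 1 + N + 1 = i + (N + 1) + 1 := fun i => by ring
        simp only [this]
        ring
    have hdf : TildeONat (fun N => PowerSeries.coeff N (PowerSeries.derivative ℝ f))
        (1 - κ - 1) := by
      have h1 : TildeONat (fun N : ℕ => ((N : ℝ) + 1)) 1 :=
        tildeONat_iff.2 ⟨1, 0, one_pos, fun N => by
          rw [abs_of_nonneg (by positivity), Real.rpow_one]
          simp⟩
      have h2 := hf.succ.mul h1
      rw [show -κ - 1 + 1 = 1 - κ - 1 by ring] at h2
      simpa only [PowerSeries.coeff_derivative] using h2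
    refine .of_derivative ?_
    have hS := tildeONat_coeff_invPow (1 / 2)
    have h1 := TildeONat.coeff_mul (by norm_num) (by linarith) hS hdf
    have h2 := (TildeONat.coeff_mul (by norm_num) (by linarith) hS htail).const_mul (-(1 / 2))
    rw [show 1 / 2 + (1 - κ) - 1 = -κ - 1 / 2 + 1 by ring] at h1 h2
    refine (h1.add h2).congr' (Eventually.of_forall fun N => ?_)
    have e : PowerSeries.derivative ℝ (invPow (1 / 2) * f) =
        invPow (1 / 2) * PowerSeries.derivative ℝ f +
          PowerSeries.C (-(1 / 2)) * (invPow (1 / 2) * t) := by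
      rw [Derivation.leibniz, derivative_invPow, smul_eq_mul, smul_eq_mul]
      have h3 : invPow (1 / 2) = invPow (1 / 2 + 1) * (1 - PowerSeries.X) := by
        rw [← invPow_neg_one, ← invPow_add]
        norm_num
      rw [add_right_inj]
      conv_lhs => rw [hft]
      conv_rhs => rw [h3, map_neg]
      ring
    simp only [e, map_add, PowerSeries.coeff_C_mul]

/-! ### Singular terms of the excursion series -/

theorem coeff_seriesE (ω : ℕ → ℝ) (ε : ℝ) (s N : ℕ) :
    PowerSeries.coeff N (seriesE ω ε s) = coeffE ω ε s N := PowerSeries.coeff_mk _ _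

theorem coeff_seriesB (ω : ℕ → ℝ) (ε : ℝ) (s N : ℕ) :
    PowerSeries.coeff N (seriesB ω ε s) = coeffB ω ε s N := PowerSeries.coeff_mk _ _

theorem coeffE_zero (ω : ℕ → ℝ) (ε : ℝ) (N : ℕ) :
    coeffE ω ε 0 N = (catalan N : ℝ) / 2 ^ (2 * N + 1) := by
  have h : excursionSum ω ε 0 N = catalan N := by
    simp [excursionSum, ← DyckWord.card_dyckWord_semilength_eq_catalan]
  rw [coeffE, h, pow_succ, pow_mul, one_div_pow]
  norm_num
  ring

theorem coeffE_zero_eq (ω : ℕ → ℝ) (ε : ℝ) (N : ℕ) :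
    coeffE ω ε 0 N = -PowerSeries.coeff (N + 1) (invPow (-1 / 2)) := by
  have h := congrArg (PowerSeries.coeff (N + 1)) (X_mul_seriesE_zero ω ε)
  rw [PowerSeries.coeff_succ_X_mul, coeff_seriesE, map_sub, PowerSeries.coeff_one,
    if_neg (Nat.succ_ne_zero N), zero_sub] at h
  exact h

/-- `E_0 = (1 - (1 - X) ^ (1/2)) / X`, and the division by `X` only shifts the coefficients. -/
theorem hasSingularTerm_seriesE_zero (ω : ℕ → ℝ) (ε : ℝ) :
    HasSingularTerm (seriesE ω ε 0) (-1 / 2) 1 (-1) := by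
  have h := (tildeONat_coeff_invPow (-1 / 2 - 1)).succ.neg
  refine (h.mono (by norm_num)).congr' (Eventually.of_forall fun N => ?_)
  have h3 : invPow (-1 / 2 - 1) = invPow (-1 / 2) - PowerSeries.X * invPow (-1 / 2) := by
    rw [sub_eq_add_neg, invPow_add, invPow_neg_one]
    ring
  simp only [coeff_seriesE, coeffE_zero_eq, h3, map_sub, PowerSeries.coeff_succ_X_mul]
  ring

theorem tildeONat_const {p : ℝ} (hp : 0 ≤ p) (a : ℝ) : TildeONat (fun _ => a) p := by
  have h : TildeONat (fun _ => a) 0 :=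
    .of_isBigO (by simpa using isBigO_const_const a (one_ne_zero (α := ℝ)) atTop)
  exact h.mono hp

theorem Gamma_neg_one_half : Real.Gamma (-1 / 2) = -(2 * √Real.pi) := by
  have h := Real.Gamma_add_one (s := -1 / 2) (by norm_num)
  rw [show (-1 / 2 + 1 : ℝ) = 1 / 2 by norm_num, Real.Gamma_one_half_eq] at h
  linarith

theorem Gamma_sub_half_ne_zero {p : ℝ} (hp : 0 < p) (hp_half : p ≠ 1 / 2) :
    Real.Gamma (p - 1 / 2) ≠ 0 := by
  refine Real.Gamma_ne_zero fun m hm => ?_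
  rcases m with _ | m
  · apply hp_half
    push_cast at hm
    linarith
  · push_cast at hm
    linarith [m.cast_nonneg (α := ℝ)]

section

variable {p η : ℝ} {ω : ℕ → ℝ}

/-- What remains of `∑ c_N ω(N) X^N` after its singular term is removed. -/
def regularPart (ω : ℕ → ℝ) (p : ℝ) : PowerSeries ℝ :=
  PowerSeries.mk (fun N => ω N * coeffE ω 0 0 N) -
    PowerSeries.C (Real.Gamma (p - 1 / 2) / (2 * √Real.pi)) * invPow (p - 1 / 2)

theorem tildeONat_regularPart (hp : 0 < p) (hp_half : p ≠ 1 / 2) (hη : 0 < η)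
    (hω : TildeONat (fun N : ℕ => ω N - (N : ℝ) ^ p) (p - η)) :
    TildeONat (fun N => PowerSeries.coeff N (regularPart ω p))
      (-(1 / 2 - p + min η (1 / 2)) - 1) := by
  have h0 : 0 ≤ min η (1 / 2) := le_min hη.le (by norm_num)
  have h1 : min η (1 / 2) ≤ 1 := (min_le_right _ _).trans (by norm_num)
  have h := ((hasSingularTerm_seriesE_zero ω 0).mono h1).hadamard (p := p) (w := ω) h0 h1
    (hω.mono (by linarith [min_le_left η (1 / 2)]))
    (by rw [show -1 / 2 + p = p - 1 / 2 by ring]; exact Gamma_sub_half_ne_zero hp hp_half)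
  rw [show -1 / 2 + p = p - 1 / 2 by ring, Gamma_neg_one_half] at h
  have h2 := TildeONat.mono h
    (show p - 1 / 2 - 1 - min η (1 / 2) ≤ -(1 / 2 - p + min η (1 / 2)) - 1 by linarith)
  refine h2.congr' (Eventually.of_forall fun N => ?_)
  simp only [regularPart, map_sub, PowerSeries.coeff_mk, PowerSeries.coeff_C_mul, coeff_seriesE]
  ring

theorem hadamardE0_eq (hp : 0 < p) (hp_half : p ≠ 1 / 2) (hη : 0 < η)
    (hω : TildeONat (fun N : ℕ => ω N - (N : ℝ) ^ p) (p - η)) {z : ℂ} (hz : ‖z‖ < 1) :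
    hadamardE0 ω z = ∑' N, ((PowerSeries.coeff N (regularPart ω p) : ℝ) : ℂ) * z ^ N +
      ((Real.Gamma (p - 1 / 2) / (2 * √Real.pi) : ℝ) : ℂ) * (1 - z) ^ ((1 / 2 - p : ℝ) : ℂ) := by
  have h1 := (tildeONat_regularPart hp hp_half hη hω).summable_mul_pow hz
  have h2 := (hasSum_invPow (p - 1 / 2) hz).mul_left
    ((Real.Gamma (p - 1 / 2) / (2 * √Real.pi) : ℝ) : ℂ)
  rw [neg_sub] at h2
  rw [← h2.tsum_eq, ← h1.tsum_add h2.summable, hadamardE0]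
  refine tsum_congr fun N => ?_
  simp only [regularPart, map_sub, PowerSeries.coeff_mk, PowerSeries.coeff_C_mul, coeffE_zero]
  push_cast
  ring

theorem isRegularConstant_iff (hp : 0 < p) (hp_half : p ≠ 1 / 2) (hη : 0 < η)
    (hω : TildeONat (fun N : ℕ => ω N - (N : ℝ) ^ p) (p - η)) (α : ℝ) :
    IsRegularConstant ω p η α ↔
    TildeO (fun z => ∑' N, ((PowerSeries.coeff N (regularPart ω p) : ℝ) : ℂ) * z ^ N - α)
      (1 / 2 - p + min η (1 / 2)) := by
  constructor
  · refine fun h => h.congr fun z hz => ?_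
    rw [hadamardE0_eq hp hp_half hη hω hz]
    ring
  · refine fun h => TildeO.congr h fun z hz => ?_
    rw [hadamardE0_eq hp hp_half hη hω hz]
    ring

theorem half_sub_add_min_lt_one (hp : 0 < p) : 1 / 2 - p + min η (1 / 2) < 1 := by
  linarith [min_le_right η (1 / 2)]

theorem exists_isRegularConstant (hp : 0 < p) (hp_half : p ≠ 1 / 2) (hη : 0 < η)
    (hω : TildeONat (fun N : ℕ => ω N - (N : ℝ) ^ p) (p - η)) :
    ∃ α : ℝ, IsRegularConstant ω p η α := by
  obtain ⟨a, ha, -⟩ := (tildeONat_regularPart hp hp_half hη hω).exists_tildeO_tsum_sub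
    (half_sub_add_min_lt_one hp)
  exact ⟨a, (isRegularConstant_iff hp hp_half hη hω a).2 ha⟩

/-- When the error term vanishes at `z = 1`, the regular constant is determined as the value of
the regular part at `1`. -/
theorem IsRegularConstant.eq_tsum {α : ℝ} (hp : 0 < p) (hp_half : p ≠ 1 / 2) (hη : 0 < η)
    (hω : TildeONat (fun N : ℕ => ω N - (N : ℝ) ^ p) (p - η)) (hα : IsRegularConstant ω p η α)
    (hκ : 0 < 1 / 2 - p + min η (1 / 2)) :
    ∑' N, PowerSeries.coeff N (regularPart ω p) = α := by
  rw [isRegularConstant_iff hp hp_half hη hω] at hα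
  obtain ⟨a, ha, ha'⟩ := (tildeONat_regularPart hp hp_half hη hω).exists_tildeO_tsum_sub
    (half_sub_add_min_lt_one hp)
  obtain ⟨c, hα⟩ := hα
  obtain ⟨d, ha⟩ := ha
  rw [← ha' hκ]
  have h : TildeO (fun _ => ((a - α : ℝ) : ℂ)) (1 / 2 - p + min η (1 / 2)) := by
    refine ⟨c + d, fun M => ?_⟩
    -- Near `z = 1` larger powers of the logarithm are larger.
    have hbig : ∀ᶠ z : ℂ in 𝓝[Complex.stolzSet M] 1, 1 ≤ |Real.log ‖1 - z‖| := by
      have h1 : Tendsto (fun z : ℂ => ‖1 - z‖) (𝓝[Complex.stolzSet M] 1) (𝓝[>] 0) := by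
        refine tendsto_nhdsWithin_of_tendsto_nhds_of_eventually_within _ ?_ ?_
        · have h : Continuous fun z : ℂ => ‖1 - z‖ := by fun_prop
          simpa using (h.tendsto 1).mono_left nhdsWithin_le_nhds
        · filter_upwards [self_mem_nhdsWithin] with z hz
          refine norm_pos_iff.2 (sub_ne_zero.2 ?_)
          rintro rfl
          simpa using hz.1
      exact ((tendsto_abs_atBot_atTop.comp Real.tendsto_log_nhdsGT_zero).comp h1).eventually
        (eventually_ge_atTop 1)
    have hup : ∀ {m n : ℕ}, m ≤ n →
        (fun z : ℂ => ‖1 - z‖ ^ (1 / 2 - p + min η (1 / 2)) * |Real.log ‖1 - z‖| ^ m)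
        =O[𝓝[Complex.stolzSet M] 1]
        fun z : ℂ => ‖1 - z‖ ^ (1 / 2 - p + min η (1 / 2)) * |Real.log ‖1 - z‖| ^ n := by
      intro m n hmn
      refine IsBigO.of_bound 1 ?_
      filter_upwards [hbig] with z hz
      rw [Real.norm_of_nonneg (by positivity), Real.norm_of_nonneg (by positivity), one_mul]
      gcongr
    have h2 := ((hα M).trans (hup (Nat.le_add_right c d))).sub
      ((ha M).trans (hup (Nat.le_add_left d c)))
    refine h2.congr_left fun z => ?_
    push_cast
    ring
  have h0 := eq_zero_of_tildeO_const hκ h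
  have : a - α = 0 := by exact_mod_cast h0
  linarith

theorem tildeONat_sub_const
    (hω : TildeONat (fun N : ℕ => ω N - (N : ℝ) ^ p) (p - η))
    (α : ℝ) {δ : ℝ} (hδη : δ ≤ η) (hδp : δ ≤ p) :
    TildeONat (fun N : ℕ => (ω N - α) - (N : ℝ) ^ p) (p - δ) := by
  have h := (hω.mono (show p - η ≤ p - δ by linarith)).sub
    (tildeONat_const (show 0 ≤ p - δ by linarith) α)
  refine h.congr' (Eventually.of_forall fun N => ?_)
  ring

theorem tildeONat_omega (hη : 0 < η)
    (hω : TildeONat (fun N : ℕ => ω N - (N : ℝ) ^ p) (p - η)) : TildeONat ω p := by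
  have := (hω.mono (show p - η ≤ p by linarith)).add (tildeONat_rpow p)
  simpa using this

theorem tildeONat_expTerm {w : ℕ → ℝ} {p : ℝ} (h : TildeONat w p) (j : ℕ) :
    TildeONat (fun N => expTerm j (w N)) (j * p) := by
  have h1 : TildeONat (fun N => w N ^ j) (j * p) := by
    induction j with
    | zero => simpa using tildeONat_const le_rfl 1
    | succ j ih =>
      have := ih.mul h
      simp only [← pow_succ] at this
      refine this.mono (le_of_eq ?_)
      push_cast
      ring
  refine (h1.const_mul (1 / (j.factorial : ℝ))).congr' (Eventually.of_forall fun N => ?_)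
  simp only [expTerm]
  ring

theorem tildeONat_seriesE_zero (ω : ℕ → ℝ) (ε : ℝ) :
    TildeONat (fun N => PowerSeries.coeff N (seriesE ω ε 0)) (-3 / 2) :=
  ((hasSingularTerm_seriesE_zero ω ε).tildeONat zero_le_one).mono (by norm_num)

/-- The solution `E_1 = ((1 - X) ^ (-1/2) - 1) Q / 2`, with the regular part and the Catalan series
separated. -/
theorem two_mul_seriesE_one (α : ℝ) : 2 * seriesE ω α 1 =
    PowerSeries.C (Real.Gamma (p - 1 / 2) / (2 * √Real.pi)) * invPow p +
      (invPow (1 / 2) * (regularPart ω p - PowerSeries.C α) +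
        PowerSeries.C α * seriesE ω α 0 -
        PowerSeries.mk fun N => (ω N - α) * PowerSeries.coeff N (seriesE ω α 0)) := by
  have h := two_mul_seriesE_succ ω α 0
  simp only [Finset.range_zero, Finset.sum_empty, mul_zero, zero_add] at h
  have hQ : seriesLift ω α 1 - seriesE ω α 1 =
      PowerSeries.mk fun N => (ω N - α) * PowerSeries.coeff N (seriesE ω α 0) := by
    ext N
    simp only [map_sub, seriesLift, PowerSeries.coeff_mk, coeff_seriesE]
    rw [Finset.Nat.sum_antidiagonal_eq_sum_range_succ
      (fun i j => expTerm i (ω N - α) * coeffE ω α j N)]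
    simp [Finset.sum_range_succ, expTerm_zero, expTerm_one]
  have hQ2 : (PowerSeries.mk fun N => (ω N - α) * PowerSeries.coeff N (seriesE ω α 0)) =
      regularPart ω p + PowerSeries.C (Real.Gamma (p - 1 / 2) / (2 * √Real.pi)) *
        invPow (p - 1 / 2) - PowerSeries.C α * seriesE ω α 0 := by
    ext N
    simp only [regularPart, map_sub, map_add, PowerSeries.coeff_mk, PowerSeries.coeff_C_mul,
      coeff_seriesE, coeffE_zero]
    ring
  have hb : invPow p = invPow (1 / 2) * invPow (p - 1 / 2) := by
    rw [← invPow_add]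
    ring_nf
  -- `(1 - X) ^ (-1/2) (1 - E_0) = E_0`
  have hE : invPow (1 / 2) * (1 - seriesE ω α 0) = seriesE ω α 0 := by
    have h1 := two_mul_seriesE ω α 0
    simp only [if_true, Finset.Nat.antidiagonal_zero, Finset.sum_singleton, seriesLift_zero] at h1
    have h2 := X_mul_seriesE_zero ω α
    linear_combination (-invPow (1 / 2)) * h1 - invPow (1 / 2) * seriesE ω α 0 * h2 +
      seriesE ω α 0 * invPow_half_mul
  rw [hQ] at h
  rw [h, hb]
  conv_lhs => enter [1]; rw [hQ2]
  linear_combination PowerSeries.C α * hE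

theorem expE_one : expE p 1 = p := by
  rw [expE]
  push_cast
  ring

theorem two_mul_muE_one : 2 * (2 * muE p 1) = Real.Gamma (p - 1 / 2) / (2 * √Real.pi) := by
  rw [muE_one]
  ring

/-- For `s = 1` no convolution of two error terms occurs, so that the exponent is not limited
by `p`. -/
theorem hasSingularTerm_seriesE_one {α : ℝ} (hp : 0 < p) (hp_half : p ≠ 1 / 2) (hη : 0 < η)
    (hω : TildeONat (fun N : ℕ => ω N - (N : ℝ) ^ p) (p - η)) (hα : IsRegularConstant ω p η α) :
    HasSingularTerm (seriesE ω α 1) (expE p 1) (min η (1 / 2)) (2 * muE p 1) := by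
  have hη1 := min_le_right η (1 / 2)
  have hη2 := min_le_left η (1 / 2)
  have hη0 : 0 ≤ min η (1 / 2) := le_min hη.le (by norm_num)
  rw [expE_one]
  apply HasSingularTerm.of_two_mul
  rw [two_mul_muE_one, two_mul_seriesE_one (p := p)]
  set H := regularPart ω p - PowerSeries.C α with hH
  have hreg := tildeONat_regularPart hp hp_half hη hω
  have hHO : TildeONat (fun N => PowerSeries.coeff N H) (-(1 / 2 - p + min η (1 / 2)) - 1) := by
    refine hreg.congr' ?_
    filter_upwards [eventually_ge_atTop 1] with N hN
    rw [hH, map_sub, PowerSeries.coeff_C, if_neg (by omega), sub_zero]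
  have hH0 : 0 < 1 / 2 - p + min η (1 / 2) → ∑' N, PowerSeries.coeff N H = 0 := by
    intro hκ
    have hs : Summable fun N => PowerSeries.coeff N (regularPart ω p) :=
      summable_abs_iff.1 (hreg.summable_abs hκ)
    have hC : HasSum (fun N => PowerSeries.coeff N (PowerSeries.C (R := ℝ) α)) α := by
      have := hasSum_ite_eq 0 α
      simpa only [PowerSeries.coeff_C] using this
    have := hs.hasSum.sub hC
    rw [hα.eq_tsum hp hp_half hη hω hκ, sub_self] at this
    simpa only [hH, map_sub] using this.tsum_eq
  have h1 := (hHO.invPow_half_mul (half_sub_add_min_lt_one hp) hH0).mono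
    (show -(1 / 2 - p + min η (1 / 2)) - 1 / 2 ≤ p - 1 - min η (1 / 2) by linarith)
  have hE0 := tildeONat_seriesE_zero ω α
  have h2 := (hE0.mono (show -3 / 2 ≤ p - 1 - min η (1 / 2) by linarith)).const_mul α
  have hw : TildeONat (fun N => ω N - α) p :=
    (tildeONat_omega hη hω).sub (tildeONat_const hp.le α)
  have h3 := (hw.mul hE0).mono (show p + -3 / 2 ≤ p - 1 - min η (1 / 2) by linarith)
  refine ((h1.add h2).sub h3).congr' (Eventually.of_forall fun N => ?_)
  simp only [map_add, map_sub, PowerSeries.coeff_C_mul, PowerSeries.coeff_mk]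
  ring

theorem le_expE (hp : 0 < p) {s : ℕ} (hs : 1 ≤ s) : p ≤ expE p s := by
  rw [expE]
  have : (1 : ℝ) ≤ s := by exact_mod_cast hs
  nlinarith

theorem expE_succ (n : ℕ) : expE p (n + 1) = expE p n + p + 1 / 2 := by
  rw [expE, expE]
  push_cast
  ring

/-- Among the terms of `seriesLift - seriesE` only the one linear in `ω - ε` is not negligible. -/
theorem tildeONat_seriesLift_sub {α : ℝ} (hw : TildeONat (fun N => ω N - α) p) {n : ℕ}
    (hE : ∀ k ≤ n, TildeONat (fun N => PowerSeries.coeff N (seriesE ω α k)) (expE p k - 1)) :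
    TildeONat (fun N => PowerSeries.coeff N (seriesLift ω α (n + 1) - seriesE ω α (n + 1)) -
      (ω N - α) * PowerSeries.coeff N (seriesE ω α n)) (expE p (n + 1) - 2) := by
  have h : TildeONat (fun N => ∑ i ∈ Finset.range n, expTerm (i + 2) (ω N - α) *
      PowerSeries.coeff N (seriesE ω α (n - 1 - i))) (expE p (n + 1) - 2) := by
    refine TildeONat.sum fun i hi => ?_
    rw [Finset.mem_range] at hi
    refine ((tildeONat_expTerm hw (i + 2)).mul (hE (n - 1 - i) (by omega))).mono ?_
    obtain ⟨k, rfl⟩ : ∃ k, n = k + 1 + i := ⟨n - 1 - i, by omega⟩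
    rw [show k + 1 + i - 1 - i = k by omega, expE, expE]
    push_cast
    nlinarith [i.cast_nonneg (α := ℝ)]
  refine h.congr' (Eventually.of_forall fun N => ?_)
  simp only [map_sub, seriesLift, PowerSeries.coeff_mk, coeff_seriesE]
  rw [Finset.Nat.sum_antidiagonal_eq_sum_range_succ
    (fun i j => expTerm i (ω N - α) * coeffE ω α j N), Finset.sum_range_succ',
    Finset.sum_range_succ', expTerm_zero, zero_add, expTerm_one, Nat.sub_zero,
    Nat.add_sub_cancel]
  have : ∀ i ∈ Finset.range n, expTerm (i + 1 + 1) (ω N - α) * coeffE ω α (n + 1 - (i + 1 + 1)) N =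
      expTerm (i + 2) (ω N - α) * coeffE ω α (n - 1 - i) N := by
    intro i hi
    rw [Finset.mem_range] at hi
    rw [show n + 1 - (i + 1 + 1) = n - 1 - i by omega]
  rw [Finset.sum_congr rfl this]
  ring

theorem tildeONat_seriesLift_sub_seriesE {α : ℝ} (hw : TildeONat (fun N => ω N - α) p) {n : ℕ}
    (hE : ∀ k ≤ n, TildeONat (fun N => PowerSeries.coeff N (seriesE ω α k)) (expE p k - 1)) :
    TildeONat (fun N => PowerSeries.coeff N (seriesLift ω α (n + 1) - seriesE ω α (n + 1)))
      (expE p (n + 1) - 1 - 1 / 2) := by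
  have h1 := (tildeONat_seriesLift_sub hw hE).mono
    (show expE p (n + 1) - 2 ≤ expE p (n + 1) - 1 - 1 / 2 by linarith)
  have h2 := (hw.mul (hE n le_rfl)).mono
    (show p + (expE p n - 1) ≤ expE p (n + 1) - 1 - 1 / 2 by rw [expE_succ]; linarith)
  refine (h1.add h2).congr' (Eventually.of_forall fun N => ?_)
  ring

theorem hasSingularTerm_seriesLift {α δ c : ℝ} (hδ : δ ≤ 1 / 2)
    (hw : TildeONat (fun N => ω N - α) p) {n : ℕ}
    (hE : ∀ k ≤ n, TildeONat (fun N => PowerSeries.coeff N (seriesE ω α k)) (expE p k - 1))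
    (h : HasSingularTerm (seriesE ω α (n + 1)) (expE p (n + 1)) δ c) :
    HasSingularTerm (seriesLift ω α (n + 1)) (expE p (n + 1)) δ c := by
  have h1 := (HasSingularTerm.of_tildeONat (tildeONat_seriesLift_sub_seriesE hw hE)).mono hδ
  have := h1.add h
  rwa [sub_add_cancel, zero_add] at this

/-- The recursion for `muE`, in the form in which it arises. -/
theorem muE_succ_succ (n : ℕ) : 2 * (2 * muE p (n + 2)) =
    ∑ i ∈ Finset.range (n + 1), 2 * muE p (i + 1) * (2 * muE p (n + 1 - i)) +
      2 * muE p (n + 1) * (Real.Gamma (expE p (n + 1) + p) / Real.Gamma (expE p (n + 1))) := by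
  have hr := muE_rec p (n + 2) (by omega)
  rw [← Finset.Ico_add_one_right_eq_Icc, Finset.sum_Ico_eq_sum_range] at hr
  have e1 : ((n + 2 : ℕ) : ℝ) * (p + 1 / 2) - 1 = expE p (n + 1) + p := by
    rw [expE]
    push_cast
    ring
  have e2 : ((n + 2 : ℕ) : ℝ) * (p + 1 / 2) - p - 1 = expE p (n + 1) := by
    rw [expE]
    push_cast
    ring
  have e3 : ∀ i ∈ Finset.range (n + 1), 2 * muE p (i + 1) * (2 * muE p (n + 1 - i)) =
      4 * (muE p (1 + i) * muE p (n + 2 - (1 + i))) := by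
    intro i _
    rw [add_comm 1 i, show n + 2 - (i + 1) = n + 1 - i by omega]
    ring
  rw [Finset.sum_congr rfl e3, ← Finset.mul_sum, hr, e1, e2, show n + 2 - 1 = n + 1 by omega]
  simp only [Nat.add_sub_cancel]
  ring

/-- The singular term of `E_s`, by induction on `s`. Besides `δ ≤ η` and `δ ≤ 1/2`, which bound the
relative errors of `ω` and of `E_0`, convolution needs `δ ≤ p`, the least exponent `expE p 1`. -/
theorem hasSingularTerm_seriesE {α : ℝ} (hp : 0 < p) (hp_half : p ≠ 1 / 2) (hη : 0 < η)
    (hω : TildeONat (fun N : ℕ => ω N - (N : ℝ) ^ p) (p - η)) (hα : IsRegularConstant ω p η α)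
    (s : ℕ) : HasSingularTerm (seriesE ω α s) (expE p s) (min η (min p (1 / 2))) (2 * muE p s) := by
  set δ := min η (min p (1 / 2)) with hδ
  have hδη : δ ≤ η := min_le_left _ _
  have hδp : δ ≤ p := (min_le_right _ _).trans (min_le_left _ _)
  have hδh : δ ≤ 1 / 2 := (min_le_right _ _).trans (min_le_right _ _)
  have hδ0 : 0 ≤ δ := le_min hη.le (le_min hp.le (by norm_num))
  have hw : TildeONat (fun N => ω N - α) p :=
    (tildeONat_omega hη hω).sub (tildeONat_const hp.le α)
  have hS : HasSingularTerm (invPow (1 / 2)) (1 / 2) δ 1 := .invPow _ _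
  induction s using Nat.strong_induction_on with
  | _ s ih =>
    rcases s with _ | _ | n
    · have h := (hasSingularTerm_seriesE_zero ω α).mono (show δ ≤ 1 by linarith)
      rw [muE_zero, expE]
      norm_num at h ⊢
      exact h
    · exact (hasSingularTerm_seriesE_one hp hp_half hη hω hα).mono (le_min hδη hδh)
    · have hE : ∀ k ≤ n + 1,
          TildeONat (fun N => PowerSeries.coeff N (seriesE ω α k)) (expE p k - 1) :=
        fun k hk => (ih k (by omega)).tildeONat hδ0
      have hβ : 0 < expE p (n + 1) := lt_of_lt_of_le hp (le_expE hp (by omega))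
      have hsucc : expE p (n + 1 + 1) = expE p (n + 1) + p + 1 / 2 := expE_succ _
      -- the quadratic terms
      have hP : HasSingularTerm (∑ i ∈ Finset.range (n + 1),
          seriesLift ω α (i + 1) * seriesE ω α (n + 1 - i)) (expE p (n + 1) + p) δ
          (∑ i ∈ Finset.range (n + 1), 2 * muE p (i + 1) * (2 * muE p (n + 1 - i))) := by
        refine HasSingularTerm.sum fun i hi => ?_
        rw [Finset.mem_range] at hi
        have hL := hasSingularTerm_seriesLift hδh hw (fun k hk => hE k (by omega))
          (ih (i + 1) (by omega))
        have := hL.mul (ih (n + 1 - i) (by omega)) hδ0 (hδp.trans (le_expE hp (by omega)))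
          (hδp.trans (le_expE hp (by omega)))
        have e : expE p (i + 1) + expE p (n + 1 - i) = expE p (n + 1) + p := by
          rw [expE, expE, expE, Nat.cast_sub (by omega)]
          push_cast
          ring
        rwa [e] at this
      -- the term linear in `ω - α`
      have hQ : HasSingularTerm (seriesLift ω α (n + 1 + 1) - seriesE ω α (n + 1 + 1))
          (expE p (n + 1) + p) δ
          (2 * muE p (n + 1) *
            (Real.Gamma (expE p (n + 1) + p) / Real.Gamma (expE p (n + 1)))) := by
        have h1 := (ih (n + 1) (by omega)).hadamard hδ0 (by linarith)
          (tildeONat_sub_const hω α hδη hδp)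
          (Real.Gamma_pos_of_pos (by linarith : 0 < expE p (n + 1) + p)).ne'
        have h2 := (tildeONat_seriesLift_sub hw hE).mono
          (show expE p (n + 1 + 1) - 2 ≤ expE p (n + 1) + p - 1 - δ by rw [hsucc]; linarith)
        refine (TildeONat.add h1 h2).congr' (Eventually.of_forall fun N => ?_)
        simp only [PowerSeries.coeff_mk]
        ring
      have hQ' := (HasSingularTerm.of_tildeONat
        (tildeONat_seriesLift_sub_seriesE hw hE)).mono hδh
      apply HasSingularTerm.of_two_mul
      rw [two_mul_seriesE_succ, muE_succ_succ]
      have hbig : δ ≤ expE p (n + 1) + p := by linarith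
      have h1 := hS.mul (hP.X_mul (by linarith)) hδ0 hδh hbig
      have h2 := hS.mul hQ hδ0 hδh hbig
      have h3 := h1.add h2
      rw [show 1 / 2 + (expE p (n + 1) + p) = expE p (n + 1 + 1) by rw [hsucc]; ring] at h3
      have h4 := h3.sub hQ'
      rwa [one_mul, one_mul, sub_zero] at h4

theorem expB_zero : expB p 0 = 1 / 2 := by simp [expB]

theorem half_le_expB (hp : 0 < p) (s : ℕ) : 1 / 2 ≤ expB p s := by
  rw [expB]
  have : (0 : ℝ) ≤ s := s.cast_nonneg
  nlinarith

/-- The singular term of `B_s`, by induction on `s`. -/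
theorem hasSingularTerm_seriesB {α : ℝ} (hp : 0 < p) (hp_half : p ≠ 1 / 2) (hη : 0 < η)
    (hω : TildeONat (fun N : ℕ => ω N - (N : ℝ) ^ p) (p - η)) (hα : IsRegularConstant ω p η α)
    (s : ℕ) : HasSingularTerm (seriesB ω α s) (expB p s) (min η (min p (1 / 2))) (muB p s) := by
  have hE := hasSingularTerm_seriesE hp hp_half hη hω hα
  set δ := min η (min p (1 / 2)) with hδ
  have hδp : δ ≤ p := (min_le_right _ _).trans (min_le_left _ _)
  have hδh : δ ≤ 1 / 2 := (min_le_right _ _).trans (min_le_right _ _)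
  have hδ0 : 0 ≤ δ := le_min hη.le (le_min hp.le (by norm_num))
  have hw : TildeONat (fun N => ω N - α) p :=
    (tildeONat_omega hη hω).sub (tildeONat_const hp.le α)
  have hS : HasSingularTerm (invPow (1 / 2)) (1 / 2) δ 1 := .invPow _ _
  induction s using Nat.strong_induction_on with
  | _ s ih =>
    rcases s with _ | n
    · rw [seriesB_zero, expB_zero, muB_zero]
      exact hS
    · have hP : HasSingularTerm (∑ i ∈ Finset.range (n + 1),
          seriesLift ω α (i + 1) * seriesB ω α (n - i)) (expE p (n + 1) + 1 / 2) δ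
          (∑ i ∈ Finset.range (n + 1), 2 * muE p (i + 1) * muB p (n - i)) := by
        refine HasSingularTerm.sum fun i hi => ?_
        rw [Finset.mem_range] at hi
        have hL := hasSingularTerm_seriesLift hδh hw
          (fun k _ => (hE k).tildeONat hδ0) (hE (i + 1))
        have := hL.mul (ih (n - i) (by omega)) hδ0 (hδp.trans (le_expE hp (by omega)))
          (hδh.trans (half_le_expB hp _))
        have e : expE p (i + 1) + expB p (n - i) = expE p (n + 1) + 1 / 2 := by
          rw [expE, expB, expE, Nat.cast_sub (by omega)]
          push_cast
          ring
        rwa [e] at this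
      have hβ : p ≤ expE p (n + 1) := le_expE hp (by omega)
      have h := hS.mul (hP.X_mul (by linarith)) hδ0 hδh (by linarith)
      rw [seriesB_succ, muB_rec p (n + 1) (by omega)]
      have e1 : 1 / 2 + (expE p (n + 1) + 1 / 2) = expB p (n + 1) := by
        rw [expE, expB]
        ring
      have e2 : 1 * ∑ i ∈ Finset.range (n + 1), 2 * muE p (i + 1) * muB p (n - i) =
          2 * ∑ k ∈ Finset.range (n + 1), muB p k * muE p (n + 1 - k) := by
        rw [one_mul, ← Finset.sum_range_reflect, Finset.mul_sum]
        refine Finset.sum_congr rfl fun i hi => ?_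
        rw [Finset.mem_range] at hi
        rw [show n + 1 - 1 - i + 1 = n + 1 - i by omega, show n - (n + 1 - 1 - i) = i by omega]
        ring
      rwa [e1, e2] at h

end

/-! ### Moments -/

theorem TildeONat.tendsto_zero {f : ℕ → ℝ} {b : ℝ} (h : TildeONat f b) (hb : b < 0) :
    Tendsto f atTop (𝓝 0) := by
  obtain ⟨C, c, hC, h⟩ := tildeONat_iff.1 h
  obtain ⟨K, hK, hlog⟩ := logWeight_pow_le_rpow (a := -b / 2) (by linarith) c
  have hlim : Tendsto (fun N : ℕ => C * K * ((N : ℝ) + 1) ^ (-(-b / 2))) atTop (𝓝 0) := by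
    have h1 := (tendsto_rpow_neg_atTop (show 0 < -b / 2 by linarith)).comp
      (tendsto_atTop_add_const_right _ (1 : ℝ) tendsto_natCast_atTop_atTop)
    simpa using h1.const_mul (C * K)
  refine squeeze_zero_norm (fun N => ?_) hlim
  have h2 := hlog 0 N (Nat.zero_le _)
  simp only [logWeight, Nat.cast_zero, zero_add, Real.log_one, add_zero, one_pow, mul_one,
    div_one] at h2
  have e : ((N : ℝ) + 1) ^ (-(-b / 2)) = ((N : ℝ) + 1) ^ b * ((N : ℝ) + 1) ^ (-b / 2) := by
    rw [← Real.rpow_add (by positivity)]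
    ring_nf
  rw [Real.norm_eq_abs, e]
  calc |f N| ≤ C * (((N : ℝ) + 1) ^ b * (K * ((N : ℝ) + 1) ^ (-b / 2))) := by
        refine (h N).trans ?_
        gcongr
        exact h2
    _ = _ := by ring

theorem TildeONat.tendsto_mul_rpow {f : ℕ → ℝ} {a x δ : ℝ} (hδ : 0 < δ)
    (h : TildeONat (fun N => f N - a * (N : ℝ) ^ x) (x - δ)) :
    Tendsto (fun N : ℕ => f N * (N : ℝ) ^ (-x)) atTop (𝓝 a) := by
  have h1 := (h.mul (tildeONat_rpow (-x))).tendsto_zero (by linarith)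
  have h2 := h1.add_const a
  rw [zero_add] at h2
  refine h2.congr' ?_
  filter_upwards [eventually_ge_atTop 1] with N hN
  have hN0 : (0 : ℝ) < N := by exact_mod_cast hN
  rw [sub_mul, mul_assoc, ← Real.rpow_add hN0]
  simp

theorem TildeONat.div {f g : ℕ → ℝ} {a b x y δ : ℝ} (hb : b ≠ 0) (hδ1 : δ ≤ 1)
    (hf : TildeONat (fun N => f N - a * (N : ℝ) ^ x) (x - δ))
    (hg : TildeONat (fun N => g N - b * (N : ℝ) ^ y) (y - 1)) :
    TildeONat (fun N => f N / g N - a / b * (N : ℝ) ^ (x - y)) (x - y - δ) := by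
  have hlim := hg.tendsto_mul_rpow one_pos
  have hne : ∀ᶠ N in atTop, g N * (N : ℝ) ^ (-y) ≠ 0 := hlim.eventually_ne hb
  have hinv : TildeONat (fun N => (g N)⁻¹) (-y) := by
    refine .of_isBigO ?_
    have h1 := ((hlim.inv₀ hb).isBigO_one ℝ).mul
      (isBigO_refl (fun N : ℕ => (N : ℝ) ^ (-y)) atTop)
    refine h1.congr' ?_ (by simp)
    filter_upwards [eventually_ge_atTop 1] with N hN
    have hN0 : (0 : ℝ) < N := by exact_mod_cast hN
    have : (N : ℝ) ^ (-y) ≠ 0 := (Real.rpow_pos_of_pos hN0 _).ne'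
    rw [mul_inv, mul_assoc, inv_mul_cancel₀ this, mul_one]
  have h1 := hf.mul hinv
  have h2 := (((tildeONat_rpow (x - y)).mul (hg.mul hinv)).const_mul (a / b)).mono
    (show x - y + (y - 1 + -y) ≤ x - y - δ by linarith)
  rw [show x - δ + -y = x - y - δ by ring] at h1
  refine (h1.sub h2).congr' ?_
  filter_upwards [eventually_ge_atTop 1, hne] with N hN hgN
  have hN0 : (0 : ℝ) < N := by exact_mod_cast hN
  have hg0 : g N ≠ 0 := left_ne_zero_of_mul hgN
  have hy : (N : ℝ) ^ y ≠ 0 := (Real.rpow_pos_of_pos hN0 _).ne'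
  rw [Real.rpow_sub hN0]
  field_simp
  ring

theorem momentE_eq (ω : ℕ → ℝ) (ε : ℝ) (s N : ℕ) :
    momentE ω ε s N = s.factorial * (PowerSeries.coeff N (seriesE ω ε s) /
      PowerSeries.coeff N (seriesE ω ε 0)) := by
  have hs : (s.factorial : ℝ) ≠ 0 := by exact_mod_cast s.factorial_ne_zero
  have h2 : (1 / 4 : ℝ) ^ N * 2 ^ (2 * N) = 1 := by
    rw [pow_mul, ← mul_pow]
    norm_num
  rw [coeff_seriesE, coeff_seriesE, coeffE_zero, momentE, coeffE]
  rw [pow_succ, div_div_eq_mul_div]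
  rcases eq_or_ne (catalan N : ℝ) 0 with h0 | h0
  · simp [h0]
  · field_simp
    linear_combination (-excursionSum ω ε s N) * h2

theorem coeff_invPow_half (N : ℕ) :
    PowerSeries.coeff N (invPow (1 / 2)) = (1 / 4) ^ N * (Nat.centralBinom N : ℝ) := by
  induction N with
  | zero => simp [coeff_zero_invPow]
  | succ N ih =>
    have h1 := coeff_succ_invPow (1 / 2) N
    have h2 : ((N : ℝ) + 1) * Nat.centralBinom (N + 1) = 2 * (2 * N + 1) * Nat.centralBinom N := by
      exact_mod_cast Nat.succ_mul_centralBinom_succ N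
    have h3 : ((N : ℝ) + 1) ≠ 0 := by positivity
    rw [ih] at h1
    apply mul_left_cancel₀ h3
    rw [h1, pow_succ]
    linear_combination (-(1 / 4) * (1 / 4) ^ N) * h2

theorem momentB_eq (ω : ℕ → ℝ) (ε : ℝ) (s N : ℕ) :
    momentB ω ε s N = s.factorial * (PowerSeries.coeff N (seriesB ω ε s) /
      PowerSeries.coeff N (invPow (1 / 2))) := by
  have hs : (s.factorial : ℝ) ≠ 0 := by exact_mod_cast s.factorial_ne_zero
  have h0 : (Nat.centralBinom N : ℝ) ≠ 0 := by exact_mod_cast (Nat.centralBinom_pos N).ne'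
  rw [coeff_seriesB, coeff_invPow_half, momentB, coeffB]
  field_simp

theorem tildeONat_momentE_sub {ω : ℕ → ℝ} {ε p δ : ℝ} {s : ℕ} (hδ1 : δ ≤ 1)
    (h : HasSingularTerm (seriesE ω ε s) (expE p s) δ (2 * muE p s)) :
    TildeONat (fun N : ℕ => momentE ω ε s N -
      4 * √Real.pi * (s.factorial : ℝ) / Real.Gamma (expE p s) * muE p s *
        (N : ℝ) ^ ((s : ℝ) * (p + 1 / 2))) ((s : ℝ) * (p + 1 / 2) - δ) := by
  have hpi : √Real.pi ≠ 0 := (Real.sqrt_pos.2 Real.pi_pos).ne'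
  have h1 := h.tildeONat_coeff_sub_rpow hδ1
  have h2 := (hasSingularTerm_seriesE_zero ω ε).tildeONat_coeff_sub_rpow le_rfl
  rw [Gamma_neg_one_half, neg_div_neg_eq] at h2
  have h3 := (TildeONat.div (by positivity) hδ1 h1 h2).const_mul (s.factorial : ℝ)
  have e : expE p s - 1 - (-1 / 2 - 1) = (s : ℝ) * (p + 1 / 2) := by
    rw [expE]
    ring
  rw [e] at h3
  refine h3.congr' (Eventually.of_forall fun N => ?_)
  simp only [momentE_eq]
  field_simp
  ring

theorem tildeONat_momentB_sub {ω : ℕ → ℝ} {ε p δ : ℝ} {s : ℕ} (hδ1 : δ ≤ 1)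
    (h : HasSingularTerm (seriesB ω ε s) (expB p s) δ (muB p s)) :
    TildeONat (fun N : ℕ => momentB ω ε s N -
      √Real.pi * (s.factorial : ℝ) / Real.Gamma (expB p s) * muB p s *
        (N : ℝ) ^ ((s : ℝ) * (p + 1 / 2))) ((s : ℝ) * (p + 1 / 2) - δ) := by
  have hpi : √Real.pi ≠ 0 := (Real.sqrt_pos.2 Real.pi_pos).ne'
  have h1 := h.tildeONat_coeff_sub_rpow hδ1
  have h2 := (HasSingularTerm.invPow (1 / 2) 1).tildeONat_coeff_sub_rpow le_rfl
  rw [Real.Gamma_one_half_eq] at h2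
  have h3 := (TildeONat.div (by positivity) hδ1 h1 h2).const_mul (s.factorial : ℝ)
  have e : expB p s - 1 - (1 / 2 - 1) = (s : ℝ) * (p + 1 / 2) := by
    rw [expB]
    ring
  rw [e] at h3
  refine h3.congr' (Eventually.of_forall fun N => ?_)
  simp only [momentB_eq]
  field_simp

/-! ### Singular behaviour of the generating functions -/

/-- Removing the singular term from the function leaves the power series of the error term. -/
theorem HasSingularTerm.tsum_sub {f : PowerSeries ℝ} {β δ c : ℝ} (h : HasSingularTerm f β δ c)
    {z : ℂ} (hz : ‖z‖ < 1) :
    ∑' N, ((PowerSeries.coeff N f - c * PowerSeries.coeff N (PAiry.invPow β) : ℝ) : ℂ) * z ^ N =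
      ∑' N, ((PowerSeries.coeff N f : ℝ) : ℂ) * z ^ N - c * (1 - z) ^ ((-β : ℝ) : ℂ) := by
  have h1 := (hasSum_invPow β hz).mul_left (c : ℂ)
  have h2 := TildeONat.summable_mul_pow h hz
  rw [← h1.tsum_eq, eq_sub_iff_add_eq, ← h2.tsum_add h1.summable]
  refine tsum_congr fun N => ?_
  push_cast
  ring

theorem HasSingularTerm.tildeO {f : PowerSeries ℝ} {β δ c : ℝ} (h : HasSingularTerm f β δ c)
    (hδ : δ ≤ β) :
    TildeO (fun z => ∑' N, ((PowerSeries.coeff N f : ℝ) : ℂ) * z ^ N -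
      c * (1 - z) ^ ((-β : ℝ) : ℂ)) (-β + δ) := by
  have h1 : TildeONat (fun N => PowerSeries.coeff N f - c * PowerSeries.coeff N (PAiry.invPow β))
      (-(-β + δ) - 1) := by
    rw [show -(-β + δ) - 1 = β - 1 - δ by ring]
    exact h
  exact (h1.tildeO_tsum (by linarith)).congr fun z hz => h.tsum_sub hz

theorem HasSingularTerm.exists_tildeO_sub {f : PowerSeries ℝ} {β δ c : ℝ}
    (h : HasSingularTerm f β δ c) (hδ : δ < β + 1) :
    ∃ a : ℂ, TildeO (fun z => ∑' N, ((PowerSeries.coeff N f : ℝ) : ℂ) * z ^ N - a -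
      c * (1 - z) ^ ((-β : ℝ) : ℂ)) (-β + δ) := by
  have h1 : TildeONat (fun N => PowerSeries.coeff N f - c * PowerSeries.coeff N (PAiry.invPow β))
      (-(-β + δ) - 1) := by
    rw [show -(-β + δ) - 1 = β - 1 - δ by ring]
    exact h
  obtain ⟨a, ha, -⟩ := h1.exists_tildeO_tsum_sub (by linarith)
  refine ⟨a, ha.congr fun z hz => ?_⟩
  rw [h.tsum_sub hz]
  ring

end

end PAiry

theorem mainTheorem2 (p η : ℝ) (hp : 0 < p) (hp_half : p ≠ 1 / 2) (hη : 0 < η) (ω : ℕ → ℝ)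
    (hω : (fun N : ℕ => ω N - (N : ℝ) ^ p) =O[atTop] fun N : ℕ => (N : ℝ) ^ (p - η)) :
    (∃ α : ℝ, PAiry.IsRegularConstant ω p η α) ∧
    ∀ α : ℝ, PAiry.IsRegularConstant ω p η α →
      -- the generating functions converge in the open unit disc
      (∀ (s : ℕ) (z : ℂ), ‖z‖ < 1 →
        Summable (fun N : ℕ => (PAiry.coeffE ω α s N : ℂ) * z ^ N) ∧
        Summable (fun N : ℕ => (PAiry.coeffB ω α s N : ℂ) * z ^ N)) ∧
      -- leading singular behaviour
      (∀ s : ℕ, 1 ≤ s →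
        PAiry.TildeO
          (fun z => PAiry.genE ω α s z -
            2 * (PAiry.muE p s : ℂ) * (1 - z) ^ ((-PAiry.expE p s : ℝ) : ℂ))
          (-PAiry.expE p s + min η (min p (1 / 2))) ∧
        PAiry.TildeO
          (fun z => PAiry.genB ω α s z -
            (PAiry.muB p s : ℂ) * (1 - z) ^ ((-PAiry.expB p s : ℝ) : ℂ))
          (-PAiry.expB p s + min η (min p (1 / 2)))) ∧
      -- the sharper error exponents `η_s` for excursions, up to an additive constant
      (∀ s : ℕ, 1 ≤ s → ∃ c : ℂ,
        PAiry.TildeO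
          (fun z => PAiry.genE ω α s z - c -
            2 * (PAiry.muE p s : ℂ) * (1 - z) ^ ((-PAiry.expE p s : ℝ) : ℂ))
          (-PAiry.expE p s + PAiry.errExp p η s)) ∧
      -- rescaled moments
      (∀ s : ℕ,
        Tendsto (fun N : ℕ => PAiry.momentE ω α s N * (N : ℝ) ^ (-((s : ℝ) * (p + 1 / 2)))) atTop
          (𝓝 (4 * √Real.pi * (s.factorial : ℝ) / Real.Gamma (PAiry.expE p s) * PAiry.muE p s)) ∧
        Tendsto (fun N : ℕ => PAiry.momentB ω α s N * (N : ℝ) ^ (-((s : ℝ) * (p + 1 / 2)))) atTop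
          (𝓝 (√Real.pi * (s.factorial : ℝ) / Real.Gamma (PAiry.expB p s) * PAiry.muB p s))) ∧
      -- rates of convergence of the moments
      (∀ s : ℕ, 1 ≤ s →
        PAiry.TildeONat
          (fun N : ℕ => PAiry.momentE ω α s N -
            4 * √Real.pi * (s.factorial : ℝ) / Real.Gamma (PAiry.expE p s) * PAiry.muE p s *
              (N : ℝ) ^ ((s : ℝ) * (p + 1 / 2)))
          ((s : ℝ) * (p + 1 / 2) - PAiry.errExp p η s) ∧
        PAiry.TildeONat
          (fun N : ℕ => PAiry.momentB ω α s N -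
            √Real.pi * (s.factorial : ℝ) / Real.Gamma (PAiry.expB p s) * PAiry.muB p s *
              (N : ℝ) ^ ((s : ℝ) * (p + 1 / 2)))
          ((s : ℝ) * (p + 1 / 2) - min η (min p (1 / 2)))) := by
  have hω' : PAiry.TildeONat (fun N : ℕ => ω N - (N : ℝ) ^ p) (p - η) := .of_isBigO hω
  refine ⟨PAiry.exists_isRegularConstant hp hp_half hη hω', fun α hα => ?_⟩
  have hE := PAiry.hasSingularTerm_seriesE hp hp_half hη hω' hα
  have hB := PAiry.hasSingularTerm_seriesB hp hp_half hη hω' hα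
  have hδ0 : 0 < min η (min p (1 / 2)) := lt_min hη (lt_min hp (by norm_num))
  have hδp : min η (min p (1 / 2)) ≤ p := (min_le_right _ _).trans (min_le_left _ _)
  have hδh : min η (min p (1 / 2)) ≤ 1 / 2 := (min_le_right _ _).trans (min_le_right _ _)
  have hδ1 : min η (min p (1 / 2)) ≤ 1 := by linarith
  have hE' : ∀ s, 1 ≤ s → PAiry.HasSingularTerm (PAiry.seriesE ω α s) (PAiry.expE p s)
      (PAiry.errExp p η s) (2 * PAiry.muE p s) := by
    intro s hs
    rw [PAiry.errExp]
    split_ifs with h1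
    · subst h1
      exact PAiry.hasSingularTerm_seriesE_one hp hp_half hη hω' hα
    · exact hE s
  have herr1 : ∀ s, PAiry.errExp p η s ≤ 1 / 2 := by
    intro s
    rw [PAiry.errExp]
    split_ifs
    · exact min_le_right _ _
    · exact hδh
  refine ⟨fun s z hz => ⟨?_, ?_⟩, fun s hs => ⟨?_, ?_⟩, fun s hs => ?_, fun s => ⟨?_, ?_⟩,
    fun s hs => ⟨?_, ?_⟩⟩
  · simpa only [PAiry.coeff_seriesE] using ((hE s).tildeONat hδ0.le).summable_mul_pow hz
  · simpa only [PAiry.coeff_seriesB] using ((hB s).tildeONat hδ0.le).summable_mul_pow hz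
  · have h := (hE s).tildeO (hδp.trans (PAiry.le_expE hp hs))
    simpa only [PAiry.genE, PAiry.coeff_seriesE, Complex.ofReal_mul, Complex.ofReal_ofNat] using h
  · have h := (hB s).tildeO (hδh.trans (PAiry.half_le_expB hp s))
    simpa only [PAiry.genB, PAiry.coeff_seriesB] using h
  · obtain ⟨c, h⟩ := (hE' s hs).exists_tildeO_sub
      (by linarith [herr1 s, PAiry.le_expE hp hs])
    refine ⟨c, ?_⟩
    simpa only [PAiry.genE, PAiry.coeff_seriesE, Complex.ofReal_mul, Complex.ofReal_ofNat] using h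
  · exact (PAiry.tildeONat_momentE_sub hδ1 (hE s)).tendsto_mul_rpow hδ0
  · exact (PAiry.tildeONat_momentB_sub hδ1 (hB s)).tendsto_mul_rpow hδ0
  · exact PAiry.tildeONat_momentE_sub (by linarith [herr1 s]) (hE' s hs)
  · exact PAiry.tildeONat_momentB_sub hδ1 (hB s)
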